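/- Let $\mathbb{K}$ be an algebraically closed field of characteristic zero and let $p\ge 2$ be an integer. Let $\sigma$ be the $\mathbb{K}$-linear endomorphism $f(x)\mapsto f(x^p)$ of the field $\mathbb{K}(x)$ of rational functions, and let $\partial=x\frac{d}{dx}$. Extend both to $\mathbb{K}(x,\log x)$, where $\log x$ denotes an element transcendental over $\mathbb{K}(x)$, by $\sigma(\log x)=p\log x$ and $\partial(\log x)=1$. A $\sigma\partial$-$\mathbb{K}(x,\log x)$-algebra is a commutative $\mathbb{K}(x,\log x)$-algebra $U$ with a ring endomorphism $\sigma$ and a derivation $\partial$ that extend those of $\mathbb{K}(x,\log x)$ and satisfy $\partial\circ\sigma=p\,\sigma\circ\partial$ on $U$ (equivalently, $\sigma$ commutes with the derivation $\delta=\log x\cdot\partial$). Let $U$ be a nonzero $\sigma\partial$-$\mathbb{K}(x,\log x)$-algebra such that $U^\sigma:=\{u\in U:\sigma(u)=u\}$ equals $\mathbb{K}$. Let $a_1,\dots,a_t\in\mathbb{K}(x)\setminus\{0\}$, and suppose that the units $y_1,\dots,y_t\in U^\times$ satisfy $\sigma(y_i)=a_iy_i$ for $i=1,\dots,t$. Then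 $y_1,\dots,y_t$ are $\partial$-dependent over $\mathbb{K}(x)$, that is, some nonzero polynomial over $\mathbb{K}(x)$ in indeterminates $Y_{i,j}$ ($1\le i\le t$, $j\ge 0$) vanishes at $Y_{i,j}=\partial^j(y_i)$, if and only if there exist $k_1,\dots,k_t\in\mathbb{Z}$, not all zero, and $g\in\mathbb{K}(x)$ such that \[\sum_{i=1}^t k_i\frac{\partial a_i}{a_i}=p\,\sigma(g)-g.\] -/

import Mathlib

open Polynomial

noncomputable section

namespace Mahler

section RatDeriv

variable {K F : Type*} [Field K] [Field F] [Algebra K F]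

/-- The quotient rule `(b a' - a b') / b ^ 2` for `f = a / b` in lowest terms, where `'` is a given
derivation `D` of the polynomial ring `F[X]`. -/
def quotRule (D : Derivation K F[X] F[X]) (f : RatFunc F) : RatFunc F :=
  (algebraMap F[X] (RatFunc F) f.denom * algebraMap F[X] (RatFunc F) (D f.num) -
      algebraMap F[X] (RatFunc F) f.num * algebraMap F[X] (RatFunc F) (D f.denom)) /
    algebraMap F[X] (RatFunc F) f.denom ^ 2

/-- The quotient rule holds for every representation as a fraction. -/
theorem quotRule_eq (D : Derivation K F[X] F[X]) (f : RatFunc F) (a b : F[X]) (hb : b ≠ 0)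
    (hf : f = algebraMap F[X] (RatFunc F) a / algebraMap F[X] (RatFunc F) b) :
    quotRule D f = (algebraMap F[X] (RatFunc F) b * algebraMap F[X] (RatFunc F) (D a) -
      algebraMap F[X] (RatFunc F) a * algebraMap F[X] (RatFunc F) (D b)) /
        algebraMap F[X] (RatFunc F) b ^ 2 := by
  have hd : f.denom ≠ 0 := f.denom_ne_zero
  have hb' : algebraMap F[X] (RatFunc F) b ≠ 0 := RatFunc.algebraMap_ne_zero hb
  have hd' : algebraMap F[X] (RatFunc F) f.denom ≠ 0 := RatFunc.algebraMap_ne_zero hd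
  have h1 : f.num * b = a * f.denom := by
    apply RatFunc.algebraMap_injective F
    have h2 := f.num_div_denom.trans hf
    rw [div_eq_div_iff hd' hb'] at h2
    simpa only [map_mul] using h2
  have h3 : f.num * D b + b * D f.num = a * D f.denom + f.denom * D a := by
    have h4 := congrArg D h1
    simpa only [Derivation.leibniz, smul_eq_mul] using h4
  have e1 := congrArg (algebraMap F[X] (RatFunc F)) h1
  have e3 := congrArg (algebraMap F[X] (RatFunc F)) h3
  simp only [map_mul, map_add] at e1 e3
  rw [quotRule, div_eq_div_iff (pow_ne_zero 2 hd') (pow_ne_zero 2 hb')]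
  linear_combination
    (algebraMap F[X] (RatFunc F) b * algebraMap F[X] (RatFunc F) f.denom) * e3 -
    (algebraMap F[X] (RatFunc F) b * algebraMap F[X] (RatFunc F) (D f.denom) +
      algebraMap F[X] (RatFunc F) f.denom * algebraMap F[X] (RatFunc F) (D b)) * e1

/-- The extension of a derivation of `F[X]` to the field `F(X)` of rational functions. -/
def ratDeriv (D : Derivation K F[X] F[X]) : Derivation K (RatFunc F) (RatFunc F) :=
  Derivation.mk'
    { toFun := quotRule D
      map_add' := fun f g => by
        have hf : algebraMap F[X] (RatFunc F) f.denom ≠ 0 :=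
          RatFunc.algebraMap_ne_zero f.denom_ne_zero
        have hg : algebraMap F[X] (RatFunc F) g.denom ≠ 0 :=
          RatFunc.algebraMap_ne_zero g.denom_ne_zero
        rw [quotRule_eq D (f + g) (f.num * g.denom + f.denom * g.num) (f.denom * g.denom)
          (mul_ne_zero f.denom_ne_zero g.denom_ne_zero) (by
            conv_lhs => rw [← f.num_div_denom, ← g.num_div_denom]
            simp only [map_mul, map_add]
            exact div_add_div _ _ hf hg)]
        simp only [quotRule, Derivation.leibniz, map_add, map_mul, smul_eq_mul]
        field_simp
        ring
      map_smul' := fun c f => by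
        have hf : algebraMap F[X] (RatFunc F) f.denom ≠ 0 :=
          RatFunc.algebraMap_ne_zero f.denom_ne_zero
        have hs : ∀ a : F[X], algebraMap F[X] (RatFunc F) (c • a) =
            c • algebraMap F[X] (RatFunc F) a := fun a => by
          rw [Algebra.smul_def, map_mul, ← IsScalarTower.algebraMap_apply, ← Algebra.smul_def]
        rw [quotRule_eq D (c • f) (c • f.num) f.denom f.denom_ne_zero (by
            conv_lhs => rw [← f.num_div_denom]
            rw [hs, smul_div_assoc])]
        simp only [quotRule, Derivation.map_smul, hs, RingHom.id_apply, mul_smul_comm, smul_mul_assoc,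
          ← smul_sub, smul_div_assoc] }
    (fun f g => by
      have hf : algebraMap F[X] (RatFunc F) f.denom ≠ 0 :=
        RatFunc.algebraMap_ne_zero f.denom_ne_zero
      have hg : algebraMap F[X] (RatFunc F) g.denom ≠ 0 :=
        RatFunc.algebraMap_ne_zero g.denom_ne_zero
      change quotRule D (f * g) = f * quotRule D g + g * quotRule D f
      rw [quotRule_eq D (f * g) (f.num * g.num) (f.denom * g.denom)
        (mul_ne_zero f.denom_ne_zero g.denom_ne_zero) (by
          conv_lhs => rw [← f.num_div_denom, ← g.num_div_denom]
          simp only [map_mul]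
          exact div_mul_div_comm _ _ _ _)]
      conv_rhs => enter [1, 1]; rw [← f.num_div_denom]
      conv_rhs => enter [2, 1]; rw [← g.num_div_denom]
      simp only [quotRule, Derivation.leibniz, map_add, map_mul, smul_eq_mul]
      field_simp
      ring)

theorem ratDeriv_algebraMap (D : Derivation K F[X] F[X]) (a : F[X]) :
    ratDeriv D (algebraMap F[X] (RatFunc F) a) = algebraMap F[X] (RatFunc F) (D a) := by
  change quotRule D _ = _
  rw [quotRule_eq D _ a 1 one_ne_zero (by simp)]
  simp

end RatDeriv

section Operators

variable (K : Type*) [Field K]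

/-- The Mahler operator `f(x) ↦ f(x ^ p)` on `K(x)`. -/
def sigma (p : ℕ) [p.AtLeastTwo] : RatFunc K →ₐ[K] RatFunc K :=
  RatFunc.mapAlgHom (Polynomial.expand K p)
    (nonZeroDivisors_le_comap_nonZeroDivisors_of_injective _
      (Polynomial.expand_injective (Nat.pos_of_ne_zero (NeZero.ne p))))

/-- The Euler derivation `∂ = x d/dx` on `K(x)`. -/
def partialD : Derivation K (RatFunc K) (RatFunc K) :=
  ratDeriv ((X : K[X]) • Polynomial.derivative')

/-- The field `K(x, log x)`: rational functions over `K(x)` in a further indeterminate, which plays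
the role of `log x`. -/
abbrev LogField : Type _ := RatFunc (RatFunc K)

/-- The element `log x` of `K(x, log x)`. -/
def logX : LogField K := RatFunc.X

/-- `σ` on the polynomial ring `K(x)[log x]`: it acts on `K(x)` as the Mahler operator and sends
`log x` to `p log x`. -/
def sigmaLogPoly (p : ℕ) [p.AtLeastTwo] : (RatFunc K)[X] →+* (RatFunc K)[X] :=
  Polynomial.eval₂RingHom ((Polynomial.C).comp (sigma K p : RatFunc K →+* RatFunc K))
    ((p : (RatFunc K)[X]) * X)

theorem coeff_sigmaLogPoly (p : ℕ) [p.AtLeastTwo] (f : (RatFunc K)[X]) (n : ℕ) :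
    (sigmaLogPoly K p f).coeff n = sigma K p (f.coeff n) * (p : RatFunc K) ^ n := by
  induction f using Polynomial.induction_on' with
  | add f g hf hg => simp only [map_add, coeff_add, hf, hg, add_mul]
  | monomial m a =>
    have h : sigmaLogPoly K p (monomial m a) =
        C (sigma K p a * (p : RatFunc K) ^ m) * X ^ m := by
      simp [sigmaLogPoly, eval₂_monomial, mul_pow, mul_assoc]
    rw [h, coeff_C_mul_X_pow, coeff_monomial]
    by_cases hmn : m = n
    · subst hmn; simp
    · simp [hmn, Ne.symm hmn]

theorem sigmaLogPoly_injective [CharZero K] (p : ℕ) [p.AtLeastTwo] :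
    Function.Injective (sigmaLogPoly K p) := by
  have : CharZero (RatFunc K) := charZero_of_injective_algebraMap (algebraMap K _).injective
  intro f g h
  ext n
  have h1 := congrArg (fun q => Polynomial.coeff q n) h
  simp only [coeff_sigmaLogPoly] at h1
  exact (sigma K p).toRingHom.injective
    (mul_right_cancel₀ (pow_ne_zero n (Nat.cast_ne_zero.mpr (NeZero.ne p))) h1)

/-- `σ` on `K(x, log x)`: the extension of the Mahler operator with `σ (log x) = p log x`. -/
def sigmaLog [CharZero K] (p : ℕ) [p.AtLeastTwo] : LogField K →+* LogField K :=
  RatFunc.mapRingHom (sigmaLogPoly K p)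
    (nonZeroDivisors_le_comap_nonZeroDivisors_of_injective _ (sigmaLogPoly_injective K p))

/-- `∂` on `K(x, log x)`: the extension of `∂ = x d/dx` with `∂ (log x) = 1`. On `K(x)[log x]` it is
the sum of `∂` applied to the coefficients and of the derivative with respect to `log x`. -/
def partialLog : Derivation K (LogField K) (LogField K) :=
  ratDeriv (PolynomialModule.equivPolynomialSelf.compDer (partialD K).mapCoeffs +
    (Polynomial.derivative' (R := RatFunc K)).restrictScalars K)

theorem sigma_algebraMap (p : ℕ) [p.AtLeastTwo] (q : K[X]) :
    sigma K p (algebraMap _ _ q) = algebraMap _ _ (Polynomial.expand K p q) := by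
  have h := RatFunc.map_apply_div (Polynomial.expand K p)
    (nonZeroDivisors_le_comap_nonZeroDivisors_of_injective _
      (Polynomial.expand_injective (Nat.pos_of_ne_zero (NeZero.ne p)))) q 1
  simp only [map_one, div_one] at h
  exact h

theorem sigma_X (p : ℕ) [p.AtLeastTwo] : sigma K p RatFunc.X = RatFunc.X ^ p := by
  rw [← RatFunc.algebraMap_X, sigma_algebraMap, expand_X, map_pow]

theorem partialD_X : partialD K RatFunc.X = RatFunc.X := by
  rw [← RatFunc.algebraMap_X, partialD, ratDeriv_algebraMap]
  simp

theorem sigmaLog_poly [CharZero K] (p : ℕ) [p.AtLeastTwo] (q : (RatFunc K)[X]) :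
    sigmaLog K p (algebraMap _ _ q) = algebraMap _ _ (sigmaLogPoly K p q) := by
  have h := RatFunc.map_apply_div (sigmaLogPoly K p)
    (nonZeroDivisors_le_comap_nonZeroDivisors_of_injective _ (sigmaLogPoly_injective K p)) q 1
  simp only [map_one, div_one] at h
  exact h

theorem sigmaLog_algebraMap [CharZero K] (p : ℕ) [p.AtLeastTwo] (f : RatFunc K) :
    sigmaLog K p (algebraMap (RatFunc K) (LogField K) f) =
      algebraMap (RatFunc K) (LogField K) (sigma K p f) := by
  rw [RatFunc.algebraMap_eq_C, ← RatFunc.algebraMap_C, sigmaLog_poly, ← RatFunc.algebraMap_C]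
  simp [sigmaLogPoly]

theorem sigmaLog_logX [CharZero K] (p : ℕ) [p.AtLeastTwo] :
    sigmaLog K p (logX K) = p * logX K := by
  rw [logX, ← RatFunc.algebraMap_X, sigmaLog_poly]
  simp [sigmaLogPoly]

theorem partialLog_algebraMap (f : RatFunc K) :
    partialLog K (algebraMap (RatFunc K) (LogField K) f) =
      algebraMap (RatFunc K) (LogField K) (partialD K f) := by
  rw [RatFunc.algebraMap_eq_C, ← RatFunc.algebraMap_C, partialLog, ratDeriv_algebraMap,
    ← RatFunc.algebraMap_C]
  congr 1
  simp [PolynomialModule.equivPolynomialSelf]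

theorem partialLog_logX : partialLog K (logX K) = 1 := by
  rw [logX, ← RatFunc.algebraMap_X, partialLog, ratDeriv_algebraMap]
  simp

end Operators

/-- A `σ∂`-`K(x, log x)`-algebra structure on the commutative `K(x, log x)`-algebra `U`: a ring
endomorphism `σ` and a derivation `∂` of `U` that extend those of `K(x, log x)` and satisfy
`∂ ∘ σ = p σ ∘ ∂`. (Equivalently, `σ` commutes with `δ = (log x) ∂`.) -/
structure SigmaPartialAlgebra (K : Type*) [Field K] [CharZero K] (p : ℕ) [p.AtLeastTwo]
    (U : Type*) [CommRing U] [Algebra (LogField K) U] where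
  /-- The endomorphism `σ` of `U`. -/
  σ : U →+* U
  /-- The derivation `∂` of `U`. -/
  d : Derivation ℤ U U
  σ_algebraMap : ∀ f : LogField K,
    σ (algebraMap (LogField K) U f) = algebraMap (LogField K) U (sigmaLog K p f)
  d_algebraMap : ∀ f : LogField K,
    d (algebraMap (LogField K) U f) = algebraMap (LogField K) U (partialLog K f)
  d_σ : ∀ u : U, d (σ u) = p * σ (d u)

/-- Elements `y i` of a ring `U` with derivation `D` are differentially dependent over `F` if some
nonzero differential polynomial over `F`, that is, a nonzero polynomial in indeterminates
`Y (i, j)` standing for the `j`-th derivative of the `i`-th element, vanishes at `y`. -/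
def DiffDependent (F : Type*) {U ι : Type*} [CommRing F] [CommRing U] [Algebra F U]
    (D : Derivation ℤ U U) (y : ι → U) : Prop :=
  ∃ P : MvPolynomial (ι × ℕ) F, P ≠ 0 ∧
    MvPolynomial.aeval (fun ij : ι × ℕ => D^[ij.2] (y ij.1)) P = 0

end Mahler

end

/-! Write `l` for `log x`, `L` for `K(x, log x)`, `z_i = ∂y_i / y_i` and `b_i = ∂a_i / a_i`.
Differentiating `σ y_i = a_i y_i` repeatedly gives `p^(j+1) σ(∂^j z_i) = ∂^j z_i + ∂^j b_i`, and the
powers of `p` disappear on passing to `w_{i,j} = l^(j+1) ∂^j z_i`, which satisfies `σ w = w +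
l^(j+1) ∂^j b_i`.

Dependence implies a relation. Bell polynomials turn a differential relation between the `y_i` into
a nonzero polynomial relation over `L` between the `y_i` and the `w_{i,j}` (`logVars_ne_zero`). A
Kolchin–Ostrowski argument (`relation_of_dependent`) leaves two cases. Either `∏ a_i^(k_i) = σh / h`
in `L`, and a logarithmic derivative finishes; or a combination of the `l^(j+1) ∂^j b_i` with
`σ`-fixed coefficients, hence coefficients in `K`, is a coboundary. Taking one coefficient in `l`
(`exists_coeff_eq`) brings the latter down to `∂^J (∑ c_i b_i) = p^(J+1) σ(g) - g` in `K(x)`.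

To remove `∂^J` and make the `c_i` integral, expand at `x = α e^u`: there `∂` is `d/du`, and `σ`
carries the expansion at `α^p` to the one at `α` with `u` replaced by `p u`. The coefficient of
`u^(-(J+1))` shows that the residue divisor of `∑ c_i b_i` on `K \ {0}` has the form `s(α^p) -
s(α)`. Since the `b_i` have integer residues, a `ℚ`-linear functional on `K` replaces the `c_i` by
integers (`exists_int_relation`), and a divisor of this form is realised by a coboundary in `K(x)`
(`exists_coboundary_of_divisor`).

Conversely, a relation makes `w = ∑ k_i z_i - g` satisfy `p σ(w) = w`, so `l w` is a constant `c` in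
`K`. Differentiating gives `w + l ∂w = 0`, and multiplication by `w` eliminates `l`: `w² + c ∂w =
0`. -/

noncomputable section

namespace Mahler

/-! ### Affine shifts of polynomial rings and their first-order expansion. -/

section Shift

variable {ι κ L : Type*} [Field L]

/-- The degree in the variables of the second kind. -/
def wdeg : (ι ⊕ κ →₀ ℕ) →+ ℕ := Finsupp.weight (Sum.elim (fun _ => 0) (fun _ => 1))

@[simp] theorem wdeg_single_inl (i : ι) (n : ℕ) :
    wdeg (Finsupp.single (Sum.inl i : ι ⊕ κ) n) = 0 := by
  simp [wdeg, Finsupp.weight_single]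

@[simp] theorem wdeg_single_inr (k : κ) (n : ℕ) :
    wdeg (Finsupp.single (Sum.inr k : ι ⊕ κ) n) = n := by
  simp [wdeg, Finsupp.weight_single]

theorem apply_inr_le_wdeg (m : ι ⊕ κ →₀ ℕ) (k : κ) : m (Sum.inr k) ≤ wdeg m := by
  have := Finsupp.le_weight (Sum.elim (fun _ => 0) (fun _ => 1) : ι ⊕ κ → ℕ)
    (s := Sum.inr k) (by simp) m
  simpa [wdeg] using this

theorem exists_apply_inr_ne_zero {m : ι ⊕ κ →₀ ℕ} (h : wdeg m ≠ 0) :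
    ∃ k : κ, m (Sum.inr k) ≠ 0 := by
  by_contra! hk
  apply h
  rw [wdeg, Finsupp.weight_apply, Finsupp.sum]
  refine Finset.sum_eq_zero fun v _ => ?_
  rcases v with i | k <;> simp [hk]

/-- Polynomials of degree at most `d` in the variables of the second kind. -/
def wdegLE (ι κ L : Type*) [Field L] (d : ℤ) : Submodule L (MvPolynomial (ι ⊕ κ) L) where
  carrier := {P | ∀ n ∈ P.support, (wdeg n : ℤ) ≤ d}
  add_mem' := fun {P Q} hP hQ n hn => by
    classical
    rcases Finset.mem_union.1 (MvPolynomial.support_add hn) with h | h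
    exacts [hP n h, hQ n h]
  zero_mem' := by simp
  smul_mem' := fun c P hP n hn => hP n (MvPolynomial.support_smul hn)

theorem coeff_eq_zero_of_mem_wdegLE {d : ℤ} {P : MvPolynomial (ι ⊕ κ) L}
    (hP : P ∈ wdegLE ι κ L d) {n : ι ⊕ κ →₀ ℕ} (hn : d < wdeg n) : MvPolynomial.coeff n P = 0 := by
  by_contra h
  exact absurd (hP n (MvPolynomial.mem_support_iff.2 h)) (not_le.2 hn)

theorem wdegLE_mono {d e : ℤ} (h : d ≤ e) {P : MvPolynomial (ι ⊕ κ) L}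
    (hP : P ∈ wdegLE ι κ L d) : P ∈ wdegLE ι κ L e := fun n hn => (hP n hn).trans h

theorem mul_mem_wdegLE {d e f : ℤ} {P Q : MvPolynomial (ι ⊕ κ) L} (hP : P ∈ wdegLE ι κ L d)
    (hQ : Q ∈ wdegLE ι κ L e) (h : d + e ≤ f) : P * Q ∈ wdegLE ι κ L f := fun n hn => by
  classical
  obtain ⟨i, hi, j, hj, rfl⟩ := Finset.mem_add.1 (MvPolynomial.support_mul P Q hn)
  have h1 := hP i hi
  have h2 := hQ j hj
  rw [map_add, Nat.cast_add]
  linarith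

theorem monomial_mem_wdegLE (m : ι ⊕ κ →₀ ℕ) (c : L) :
    MvPolynomial.monomial m c ∈ wdegLE ι κ L (wdeg m) := fun n hn => by
  have := MvPolynomial.support_monomial_subset hn
  rw [Finset.mem_singleton.1 this]

theorem C_mem_wdegLE (c : L) : (MvPolynomial.C c : MvPolynomial (ι ⊕ κ) L) ∈ wdegLE ι κ L 0 := by
  simpa using monomial_mem_wdegLE (0 : ι ⊕ κ →₀ ℕ) c

theorem X_inl_mem_wdegLE (i : ι) :
    (MvPolynomial.X (Sum.inl i) : MvPolynomial (ι ⊕ κ) L) ∈ wdegLE ι κ L 0 := by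
  simpa [MvPolynomial.X] using monomial_mem_wdegLE (Finsupp.single (Sum.inl i : ι ⊕ κ) 1) (1 : L)

theorem X_inr_mem_wdegLE (k : κ) :
    (MvPolynomial.X (Sum.inr k) : MvPolynomial (ι ⊕ κ) L) ∈ wdegLE ι κ L 1 := by
  simpa [MvPolynomial.X] using monomial_mem_wdegLE (Finsupp.single (Sum.inr k : ι ⊕ κ) 1) (1 : L)

variable (σ : L →+* L) (a : ι → L) (b : κ → L)

/-- The `σ`-semilinear endomorphism with `Y_i ↦ a_i Y_i` and `W_k ↦ W_k + b_k`. -/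
def shift : MvPolynomial (ι ⊕ κ) L →+* MvPolynomial (ι ⊕ κ) L :=
  MvPolynomial.eval₂Hom (MvPolynomial.C.comp σ)
    (Sum.elim (fun i => MvPolynomial.C (a i) * MvPolynomial.X (Sum.inl i)) fun k =>
      MvPolynomial.X (Sum.inr k) + MvPolynomial.C (b k))

/-- The `σ`-semilinear endomorphism with `Y_i ↦ a_i Y_i` and `W_k ↦ W_k`. -/
def scale : MvPolynomial (ι ⊕ κ) L →+* MvPolynomial (ι ⊕ κ) L :=
  MvPolynomial.eval₂Hom (MvPolynomial.C.comp σ)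
    (Sum.elim (fun i => MvPolynomial.C (a i) * MvPolynomial.X (Sum.inl i)) fun k =>
      MvPolynomial.X (Sum.inr k))

/-- The derivation `∑ b_k ∂/∂W_k`. -/
def shiftDeriv : Derivation L (MvPolynomial (ι ⊕ κ) L) (MvPolynomial (ι ⊕ κ) L) :=
  MvPolynomial.mkDerivation L (Sum.elim (fun _ => 0) fun k => MvPolynomial.C (b k))

/-- The error of the first order Taylor expansion of `shift`. -/
def taylorRem : MvPolynomial (ι ⊕ κ) L →+ MvPolynomial (ι ⊕ κ) L :=
  (shift σ a b).toAddMonoidHom - (scale σ a).toAddMonoidHom -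
    (shiftDeriv (ι := ι) b : MvPolynomial (ι ⊕ κ) L →+ _).comp (scale σ a).toAddMonoidHom

theorem taylorRem_apply (P : MvPolynomial (ι ⊕ κ) L) :
    taylorRem σ a b P = shift σ a b P - scale σ a P - shiftDeriv b (scale σ a P) := rfl

theorem scale_monomial [Fintype ι] (m : ι ⊕ κ →₀ ℕ) (c : L) :
    scale σ a (MvPolynomial.monomial m c) =
      MvPolynomial.monomial m ((∏ i, a i ^ m (Sum.inl i)) * σ c) := by
  -- Phrasing the claim as a passage from `n` to `n + m'` makes it additive in `m'`, as
  -- `Finsupp.induction_linear` requires.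
  suffices h : ∀ m' : ι ⊕ κ →₀ ℕ, ∀ n : ι ⊕ κ →₀ ℕ, ∀ c : L,
      scale σ a (MvPolynomial.monomial n c) =
        MvPolynomial.monomial n ((∏ i, a i ^ n (Sum.inl i)) * σ c) →
      scale σ a (MvPolynomial.monomial (n + m') c) =
        MvPolynomial.monomial (n + m') ((∏ i, a i ^ (n + m') (Sum.inl i)) * σ c) by
    simpa using h m 0 c (by simp [scale, MvPolynomial.C_mul'])
  intro m'
  induction m' using Finsupp.induction_linear with
  | zero => simp
  | add f g hf hg => intro n c hn; rw [← add_assoc]; exact hg _ _ (hf _ _ hn)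
  | single v e =>
    induction e with
    | zero => simp
    | succ e ih =>
      intro n c hn
      rw [Finsupp.single_add, ← add_assoc]
      have h1 := ih n c hn
      set n' := n + Finsupp.single v e
      have h2 : ∀ c : L, MvPolynomial.monomial (n' + Finsupp.single v 1) c =
          MvPolynomial.monomial n' c * MvPolynomial.X v := by
        intro c; simp [MvPolynomial.X, MvPolynomial.monomial_mul]
      rw [h2, map_mul, h1]
      rcases v with i | k
      · have : (∏ j, a j ^ (n' + Finsupp.single (Sum.inl i) 1 : ι ⊕ κ →₀ ℕ) (Sum.inl j)) =
            a i * ∏ j, a j ^ n' (Sum.inl j) := by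
          classical
          simp only [Finsupp.add_apply, pow_add, Finset.prod_mul_distrib]
          rw [mul_comm]
          congr 1
          rw [Finset.prod_eq_single i] <;> simp +contextual
        rw [this, h2, show scale σ a (MvPolynomial.X (Sum.inl i)) =
          MvPolynomial.C (a i) * MvPolynomial.X (Sum.inl i : ι ⊕ κ) by
          simp [scale], mul_assoc (a i), ← MvPolynomial.C_mul_monomial (a := a i)]
        ring
      · rw [h2, show scale σ a (MvPolynomial.X (Sum.inr k)) =
          MvPolynomial.X (Sum.inr k : ι ⊕ κ) by simp [scale]]
        simp

theorem coeff_scale [Fintype ι] (P : MvPolynomial (ι ⊕ κ) L) (n : ι ⊕ κ →₀ ℕ) :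
    MvPolynomial.coeff n (scale σ a P) = (∏ i, a i ^ n (Sum.inl i)) * σ (MvPolynomial.coeff n P) := by
  classical
  induction P using MvPolynomial.induction_on' with
  | monomial m c =>
    rw [scale_monomial, MvPolynomial.coeff_monomial, MvPolynomial.coeff_monomial]
    split_ifs with h
    · rw [h]
    · simp
  | add p q hp hq => simp only [map_add, MvPolynomial.coeff_add, hp, hq, mul_add]

/-- Multiply by one variable at a time. If a monomial has shift `M + D + R`, multiplication by `W_k`
changes the remainder to `D b_k + R W_k + R b_k`, so the bounds on `D` and `R` must be carried
together. Degrees are integers so that `-1` and `-2` are legitimate bounds, forcing zero. -/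
theorem taylorRem_monomial_mem [Fintype ι] (m : ι ⊕ κ →₀ ℕ) (c : L) :
    taylorRem σ a b (MvPolynomial.monomial m c) ∈ wdegLE ι κ L (wdeg m - 2) ∧
      shiftDeriv b (scale σ a (MvPolynomial.monomial m c)) ∈ wdegLE ι κ L (wdeg m - 1) := by
  let T : (ι ⊕ κ →₀ ℕ) → Prop := fun m =>
    taylorRem σ a b (MvPolynomial.monomial m c) ∈ wdegLE ι κ L (wdeg m - 2) ∧
      shiftDeriv b (scale σ a (MvPolynomial.monomial m c)) ∈ wdegLE ι κ L (wdeg m - 1)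
  suffices h : ∀ m' n : ι ⊕ κ →₀ ℕ, T n → T (n + m') by
    have h0 : T 0 := by
      have h1 : shiftDeriv b (scale σ a (MvPolynomial.C c : MvPolynomial (ι ⊕ κ) L)) = 0 := by
        simp [scale, shiftDeriv]
      have h2 : taylorRem σ a b (MvPolynomial.C c : MvPolynomial (ι ⊕ κ) L) = 0 := by
        rw [taylorRem_apply, h1]; simp [scale, shift]
      constructor
      · rw [MvPolynomial.monomial_zero', h2]; exact Submodule.zero_mem _
      · rw [MvPolynomial.monomial_zero', h1]; exact Submodule.zero_mem _
    simpa using h m 0 h0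
  intro m'
  induction m' using Finsupp.induction_linear with
  | zero => simp
  | add f g hf hg => intro n hn; rw [← add_assoc]; exact hg _ (hf _ hn)
  | single v e =>
    induction e with
    | zero => simp
    | succ e ih =>
      intro n hn
      rw [Finsupp.single_add, ← add_assoc]
      have h1 := ih n hn
      set n' := n + Finsupp.single v e
      obtain ⟨hr, hd⟩ := h1
      have h2 : MvPolynomial.monomial (n' + Finsupp.single v 1) c =
          MvPolynomial.monomial n' c * MvPolynomial.X v := by
        simp [MvPolynomial.X, MvPolynomial.monomial_mul]
      have hM : scale σ a (MvPolynomial.monomial n' c) ∈ wdegLE ι κ L (wdeg n') := by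
        rw [scale_monomial]; exact monomial_mem_wdegLE _ _
      have h3 := taylorRem_apply σ a b (MvPolynomial.monomial n' c)
      have h4 : shift σ a b (MvPolynomial.monomial n' c) = scale σ a (MvPolynomial.monomial n' c) +
        shiftDeriv b (scale σ a (MvPolynomial.monomial n' c)) +
        taylorRem σ a b (MvPolynomial.monomial n' c) := by
        rw [h3]; ring
      change taylorRem σ a b (MvPolynomial.monomial _ c) ∈ _ ∧
        shiftDeriv b (scale σ a (MvPolynomial.monomial _ c)) ∈ _
      rw [h2, taylorRem_apply, map_mul, map_mul, h4, Derivation.leibniz]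
      set M := scale σ a (MvPolynomial.monomial n' c)
      set D := shiftDeriv b M
      set R := taylorRem σ a b (MvPolynomial.monomial n' c)
      rcases v with i | k
      · have e1 : scale σ a (MvPolynomial.X (Sum.inl i)) =
            MvPolynomial.C (a i) * MvPolynomial.X (Sum.inl i : ι ⊕ κ) := by simp [scale]
        have e2 : shift σ a b (MvPolynomial.X (Sum.inl i)) =
            MvPolynomial.C (a i) * MvPolynomial.X (Sum.inl i : ι ⊕ κ) := by simp [shift]
        have e3 : shiftDeriv b (MvPolynomial.C (a i) * MvPolynomial.X (Sum.inl i : ι ⊕ κ)) = 0 := by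
          simp [shiftDeriv, MvPolynomial.mkDerivation_X]
        have hX : MvPolynomial.C (a i) * MvPolynomial.X (Sum.inl i : ι ⊕ κ) ∈ wdegLE ι κ L 0 :=
          mul_mem_wdegLE (C_mem_wdegLE _) (X_inl_mem_wdegLE i) (by simp)
        rw [e1, e2, e3, map_add, wdeg_single_inl, smul_zero, zero_add, smul_eq_mul, add_zero]
        constructor
        · rw [show (M + D + R) * (MvPolynomial.C (a i) * MvPolynomial.X (Sum.inl i)) -
            M * (MvPolynomial.C (a i) * MvPolynomial.X (Sum.inl i)) -
            MvPolynomial.C (a i) * MvPolynomial.X (Sum.inl i) * D =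
            R * (MvPolynomial.C (a i) * MvPolynomial.X (Sum.inl i)) by ring]
          exact mul_mem_wdegLE hr hX (by simp)
        · exact mul_mem_wdegLE hX hd (by simp)
      · have e1 : scale σ a (MvPolynomial.X (Sum.inr k)) =
            MvPolynomial.X (Sum.inr k : ι ⊕ κ) := by simp [scale]
        have e2 : shift σ a b (MvPolynomial.X (Sum.inr k)) =
            MvPolynomial.X (Sum.inr k : ι ⊕ κ) + MvPolynomial.C (b k) := by simp [shift]
        have e3 : shiftDeriv b (MvPolynomial.X (Sum.inr k : ι ⊕ κ)) = MvPolynomial.C (b k) := by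
          simp [shiftDeriv, MvPolynomial.mkDerivation_X]
        have hX := X_inr_mem_wdegLE (ι := ι) (L := L) k
        have hC := C_mem_wdegLE (ι := ι) (κ := κ) (b k)
        rw [e1, e2, e3, map_add, wdeg_single_inr, smul_eq_mul, smul_eq_mul]
        constructor
        · rw [show (M + D + R) * (MvPolynomial.X (Sum.inr k) + MvPolynomial.C (b k)) -
            M * MvPolynomial.X (Sum.inr k) -
            (M * MvPolynomial.C (b k) + MvPolynomial.X (Sum.inr k) * D) =
            D * MvPolynomial.C (b k) + (R * MvPolynomial.X (Sum.inr k) + R * MvPolynomial.C (b k))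
            by ring]
          refine add_mem (mul_mem_wdegLE hd hC ?_)
            (add_mem (mul_mem_wdegLE hr hX ?_) (mul_mem_wdegLE hr hC ?_)) <;> push_cast <;> linarith
        · refine add_mem (mul_mem_wdegLE hM hC ?_) (mul_mem_wdegLE hX hd ?_) <;>
            push_cast <;> linarith

theorem taylorRem_mem [Fintype ι] {d : ℤ} {P : MvPolynomial (ι ⊕ κ) L}
    (hP : P ∈ wdegLE ι κ L d) : taylorRem σ a b P ∈ wdegLE ι κ L (d - 2) := by
  rw [← P.support_sum_monomial_coeff, map_sum]
  exact sum_mem fun m hm =>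
    wdegLE_mono (by have := hP m hm; linarith) (taylorRem_monomial_mem σ a b m _).1

theorem shiftDeriv_scale_mem [Fintype ι] {d : ℤ} {P : MvPolynomial (ι ⊕ κ) L}
    (hP : P ∈ wdegLE ι κ L d) : shiftDeriv b (scale σ a P) ∈ wdegLE ι κ L (d - 1) := by
  rw [← P.support_sum_monomial_coeff, map_sum, map_sum]
  exact sum_mem fun m hm =>
    wdegLE_mono (by have := hP m hm; linarith) (taylorRem_monomial_mem σ a b m _).2

theorem shift_eq (P : MvPolynomial (ι ⊕ κ) L) :
    shift σ a b P = scale σ a P + (shiftDeriv b (scale σ a P) + taylorRem σ a b P) := by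
  rw [taylorRem_apply]; ring

/-- In top degree the derivative and the remainder contribute nothing, so the shift acts diagonally
on monomials. -/
theorem coeff_shift_of_le [Fintype ι] {d : ℤ} {P : MvPolynomial (ι ⊕ κ) L}
    (hP : P ∈ wdegLE ι κ L d) {n : ι ⊕ κ →₀ ℕ} (hn : d ≤ wdeg n) :
    MvPolynomial.coeff n (shift σ a b P) = (∏ i, a i ^ n (Sum.inl i)) * σ (MvPolynomial.coeff n P) := by
  rw [shift_eq, MvPolynomial.coeff_add, MvPolynomial.coeff_add, coeff_scale,
    coeff_eq_zero_of_mem_wdegLE (shiftDeriv_scale_mem σ a b hP) (by linarith),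
    coeff_eq_zero_of_mem_wdegLE (taylorRem_mem σ a b hP) (by linarith)]
  ring

/-- As `κ` may be infinite, the derivation is a finite sum of partial derivatives only on the
variables of `P`. Allowing every larger `S` lets a prescribed index be added later. -/
theorem coeff_shiftDeriv (P : MvPolynomial (ι ⊕ κ) L) :
    ∃ S₀ : Finset κ, ∀ S : Finset κ, S₀ ⊆ S → ∀ n, MvPolynomial.coeff n (shiftDeriv b P) =
      ∑ k ∈ S, b k *
        (MvPolynomial.coeff (n + Finsupp.single (Sum.inr k) 1) P * (n (Sum.inr k) + 1)) := by
  classical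
  refine ⟨P.vars.toRight, fun S hS n => ?_⟩
  have hsum : ∀ (f : κ → Derivation L (MvPolynomial (ι ⊕ κ) L) (MvPolynomial (ι ⊕ κ) L)) Q,
      (∑ k ∈ S, f k) Q = ∑ k ∈ S, f k Q := fun f Q => by
    rw [← Derivation.coeFnAddMonoidHom_apply, map_sum, Finset.sum_apply]
    rfl
  have h : shiftDeriv b P = (∑ k ∈ S, b k • MvPolynomial.pderiv (R := L)
      (Sum.inr k : ι ⊕ κ)) P := by
    apply MvPolynomial.derivation_eq_of_forall_mem_vars
    intro v hv
    rw [shiftDeriv, MvPolynomial.mkDerivation_X, hsum]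
    rcases v with i | k
    · simp [MvPolynomial.pderiv_X]
    · have hk : k ∈ S := hS (by simpa using hv)
      rw [Finset.sum_eq_single k]
      · simp [MvPolynomial.smul_eq_C_mul]
      · intro j _ hj
        simp [MvPolynomial.pderiv_X, hj.symm]
      · exact fun h => absurd hk h
  rw [h, hsum, MvPolynomial.coeff_sum]
  refine Finset.sum_congr rfl fun k _ => ?_
  rw [Derivation.smul_apply, MvPolynomial.coeff_smul, MvPolynomial.coeff_pderiv, smul_eq_mul]

theorem coeff_shift_of_add_one_eq [Fintype ι] {d : ℤ} {P : MvPolynomial (ι ⊕ κ) L}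
    (hP : P ∈ wdegLE ι κ L d) :
    ∃ S₀ : Finset κ, ∀ S : Finset κ, S₀ ⊆ S → ∀ n, d ≤ wdeg n + 1 →
      MvPolynomial.coeff n (shift σ a b P) =
      (∏ i, a i ^ n (Sum.inl i)) * (σ (MvPolynomial.coeff n P) + ∑ k ∈ S, b k *
        (σ (MvPolynomial.coeff (n + Finsupp.single (Sum.inr k) 1) P) * (n (Sum.inr k) + 1))) := by
  obtain ⟨S₀, hS₀⟩ := coeff_shiftDeriv b (scale σ a P)
  refine ⟨S₀, fun S hS n hn => ?_⟩
  rw [shift_eq, MvPolynomial.coeff_add, MvPolynomial.coeff_add, coeff_scale,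
    coeff_eq_zero_of_mem_wdegLE (taylorRem_mem σ a b hP) (by linarith), hS₀ S hS, add_zero,
    mul_add, Finset.mul_sum]
  congr 1
  refine Finset.sum_congr rfl fun k _ => ?_
  rw [coeff_scale]
  simp only [Finsupp.add_apply]
  simp
  ring

end Shift

/-! ### The Kolchin–Ostrowski argument. -/

section Relations

variable {ι κ L : Type*} [Field L] (σ : L →+* L) (a : ι → L) (b : κ → L)

theorem shift_mem_wdegLE [Fintype ι] {d : ℤ} {P : MvPolynomial (ι ⊕ κ) L}
    (hP : P ∈ wdegLE ι κ L d) : shift σ a b P ∈ wdegLE ι κ L d := fun n hn => by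
  by_contra! h
  refine MvPolynomial.mem_support_iff.1 hn ?_
  rw [coeff_shift_of_le σ a b hP h.le, coeff_eq_zero_of_mem_wdegLE hP h, map_zero, mul_zero]

theorem exists_mem_wdegLE (P : MvPolynomial (ι ⊕ κ) L) : ∃ d : ℕ, P ∈ wdegLE ι κ L d :=
  ⟨P.support.sup wdeg, fun _ hn => Nat.cast_le.2 (Finset.le_sup (f := wdeg) hn)⟩

/-- A nonzero element of an ideal `I` stable under `shift`, of minimal degree and with the
least number of terms of that degree, is an eigenvector of `shift`. -/
theorem exists_eigenvector [Fintype ι] {I : Ideal (MvPolynomial (ι ⊕ κ) L)}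
    (hI : ∀ P ∈ I, shift σ a b P ∈ I) (hI0 : I ≠ ⊥) :
    ∃ P ∈ I, ∃ m₀ : ι ⊕ κ →₀ ℕ, MvPolynomial.coeff m₀ P = 1 ∧ P ∈ wdegLE ι κ L (wdeg m₀) ∧
      shift σ a b P = MvPolynomial.C (∏ i, a i ^ m₀ (Sum.inl i)) * P := by
  classical
  have hex : ∃ d : ℕ, ∃ P ∈ I, P ≠ 0 ∧ P ∈ wdegLE ι κ L d := by
    obtain ⟨P, hP, h0⟩ := Submodule.exists_mem_ne_zero_of_ne_bot hI0
    obtain ⟨d, hd⟩ := exists_mem_wdegLE P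
    exact ⟨d, P, hP, h0, hd⟩
  let d := Nat.find hex
  have hmin : ∀ Q ∈ I, Q ≠ 0 → ∀ e : ℕ, Q ∈ wdegLE ι κ L e → d ≤ e := fun Q hQ h0 e he =>
    Nat.find_min' hex ⟨Q, hQ, h0, he⟩
  have htop : ∀ Q ∈ I, Q ≠ 0 → Q ∈ wdegLE ι κ L d → ∃ m ∈ Q.support, wdeg m = d := by
    intro Q hQ h0 hd
    by_contra! h
    have hlt : ∀ m ∈ Q.support, wdeg m < d := fun m hm =>
      lt_of_le_of_ne (Nat.cast_le.1 (hd m hm)) (h m hm)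
    obtain ⟨m, hm⟩ := MvPolynomial.support_nonempty.2 h0
    have h1 := hlt m hm
    have := hmin Q hQ h0 (d - 1) fun m hm => Nat.cast_le.2 (by have := hlt m hm; omega)
    omega
  have hex' : ∃ N : ℕ, ∃ P ∈ I, P ≠ 0 ∧ P ∈ wdegLE ι κ L d ∧
      (P.support.filter fun m => wdeg m = d).card = N := by
    obtain ⟨P, hP, h0, hd⟩ := Nat.find_spec hex
    exact ⟨_, P, hP, h0, hd, rfl⟩
  obtain ⟨P, hP, h0, hd, hN⟩ := Nat.find_spec hex'
  have hminN : ∀ Q ∈ I, Q ≠ 0 → Q ∈ wdegLE ι κ L d →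
      (P.support.filter fun m => wdeg m = d).card ≤
        (Q.support.filter fun m => wdeg m = d).card := fun Q hQ h0 hd => by
    rw [hN]
    exact Nat.find_min' hex' ⟨Q, hQ, h0, hd, rfl⟩
  obtain ⟨m₀, hm₀, hdm⟩ := htop P hP h0 hd
  have hc : MvPolynomial.coeff m₀ P ≠ 0 := MvPolynomial.mem_support_iff.1 hm₀
  set c := MvPolynomial.coeff m₀ P
  have hP' : MvPolynomial.C c⁻¹ * P ∈ I := I.mul_mem_left _ hP
  have hd' : MvPolynomial.C c⁻¹ * P ∈ wdegLE ι κ L d :=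
    mul_mem_wdegLE (C_mem_wdegLE _) hd (by simp)
  have hcoef : ∀ m, MvPolynomial.coeff m (MvPolynomial.C c⁻¹ * P) =
    c⁻¹ * MvPolynomial.coeff m P := fun m => MvPolynomial.coeff_C_mul _ _ _
  have h1 : MvPolynomial.coeff m₀ (MvPolynomial.C c⁻¹ * P) = 1 := by
    rw [hcoef]; exact inv_mul_cancel₀ hc
  refine ⟨MvPolynomial.C c⁻¹ * P, hP', m₀, h1, by rwa [hdm], ?_⟩
  set P' := MvPolynomial.C c⁻¹ * P
  set μ := ∏ i, a i ^ m₀ (Sum.inl i) with hμ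
  rw [← sub_eq_zero]
  by_contra hQ0
  have hQI : shift σ a b P' - MvPolynomial.C μ * P' ∈ I :=
    I.sub_mem (hI _ hP') (I.mul_mem_left _ hP')
  have hQd : shift σ a b P' - MvPolynomial.C μ * P' ∈ wdegLE ι κ L d :=
    sub_mem (shift_mem_wdegLE σ a b hd') (mul_mem_wdegLE (C_mem_wdegLE _) hd' (by simp))
  -- The defect lies in `I` and has no new terms of degree `d`, because the shift is diagonal there;
  -- its `m₀` term cancels. If nonzero, it would contradict the minimal number of top terms.
  refine absurd (hminN _ hQI hQ0 hQd) (not_le.2 (Finset.card_lt_card ?_))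
  have hQc : ∀ m, wdeg m = d →
      MvPolynomial.coeff m (shift σ a b P' - MvPolynomial.C μ * P') =
        (∏ i, a i ^ m (Sum.inl i)) * σ (MvPolynomial.coeff m P') -
          μ * MvPolynomial.coeff m P' := fun m hm => by
    rw [MvPolynomial.coeff_sub, MvPolynomial.coeff_C_mul, coeff_shift_of_le σ a b hd' (by rw [hm])]
  refine (Finset.ssubset_iff_of_subset ?_).2 ⟨m₀, ?_, ?_⟩
  · intro m hm
    rw [Finset.mem_filter, MvPolynomial.mem_support_iff] at hm ⊢
    refine ⟨fun h => hm.1 ?_, hm.2⟩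
    rw [hQc m hm.2, hcoef, h]
    simp
  · exact Finset.mem_filter.2 ⟨hm₀, hdm⟩
  · rw [Finset.mem_filter, MvPolynomial.mem_support_iff, hQc m₀ hdm, h1]
    simp [hμ]

/-- A difference version of the theorem of Kolchin and Ostrowski: a polynomial relation between
solutions of the equations `σ y = a y` and `σ w = w + b` forces a multiplicative relation between
the `a`'s or a linear relation between the `b`'s, up to coboundaries. -/
theorem relation_of_dependent [Fintype ι] [CharZero L] (ha : ∀ i, a i ≠ 0)
    {U : Type*} [CommRing U] [Nontrivial U] [Algebra L U] (s : U →+* U)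
    (hs : ∀ f, s (algebraMap L U f) = algebraMap L U (σ f))
    (y : ι → Uˣ) (hy : ∀ i, s (y i) = algebraMap L U (a i) * y i)
    (w : κ → U) (hw : ∀ k, s (w k) = w k + algebraMap L U (b k))
    {P : MvPolynomial (ι ⊕ κ) L} (hP0 : P ≠ 0)
    (hP : MvPolynomial.aeval (Sum.elim (fun i => (y i : U)) w) P = 0) :
    (∃ k : ι → ℤ, k ≠ 0 ∧ ∃ h : L, h ≠ 0 ∧ ∏ i, a i ^ k i = σ h / h) ∨
      ∃ (S : Finset κ) (c : κ → L) (h : L), (∃ k ∈ S, c k ≠ 0) ∧ (∀ k, σ (c k) = c k) ∧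
        ∑ k ∈ S, c k * b k = σ h - h := by
  classical
  set ev := MvPolynomial.aeval (R := L) (Sum.elim (fun i => (y i : U)) w) with hev
  have hcomm : ∀ Q, ev (shift σ a b Q) = s (ev Q) := by
    suffices h : (ev : _ →+* U).comp (shift σ a b) = s.comp (ev : _ →+* U) from
      fun Q => RingHom.congr_fun h Q
    apply MvPolynomial.ringHom_ext
    · intro r
      simp [shift, hs]
    · rintro (i | k) <;> simp [shift, hev, hy, hw]
  obtain ⟨P, hPI, m₀, h1, hd, heig⟩ := exists_eigenvector σ a b (I := RingHom.ker ev)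
    (fun Q hQ => by
      rw [RingHom.mem_ker] at hQ ⊢
      rw [hcomm, hQ, map_zero])
    (fun h => hP0 (by
      have : P ∈ RingHom.ker ev := hP
      rwa [h] at this))
  clear hP0 hP
  have htop : ∀ m : ι ⊕ κ →₀ ℕ, wdeg m = wdeg m₀ →
      (∏ i, a i ^ m (Sum.inl i)) * σ (MvPolynomial.coeff m P) =
        (∏ i, a i ^ m₀ (Sum.inl i)) * MvPolynomial.coeff m P := fun m hm => by
    rw [← coeff_shift_of_le σ a b hd (by rw [hm]), heig, MvPolynomial.coeff_C_mul]
  have hprod : ∀ m : ι ⊕ κ →₀ ℕ, (∏ i, a i ^ m (Sum.inl i)) ≠ 0 := fun m =>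
    Finset.prod_ne_zero_iff.2 fun i _ => pow_ne_zero _ (ha i)
  -- Two top monomials with different `Y`-exponents give the multiplicative relation, with `h` the
  -- coefficient at `m`. Otherwise all top coefficients are fixed by `σ`.
  by_cases hα : ∃ m ∈ P.support, wdeg m = wdeg m₀ ∧ ∃ i, m (Sum.inl i) ≠ m₀ (Sum.inl i)
  · left
    obtain ⟨m, hm, hdm, i, hi⟩ := hα
    refine ⟨fun i => (m₀ (Sum.inl i) : ℤ) - m (Sum.inl i), fun h => hi ?_,
      MvPolynomial.coeff m P, MvPolynomial.mem_support_iff.1 hm, ?_⟩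
    · have := congrFun h i
      simp only [Pi.zero_apply] at this
      omega
    · rw [eq_div_iff (MvPolynomial.mem_support_iff.1 hm)]
      apply mul_left_cancel₀ (hprod m)
      rw [htop m hdm, ← mul_assoc, ← Finset.prod_mul_distrib]
      congr 1
      refine Finset.prod_congr rfl fun i _ => ?_
      rw [← zpow_natCast, ← zpow_natCast, ← zpow_add₀ (ha i)]
      congr 1
      ring
  right
  push Not at hα
  have hfix : ∀ m : ι ⊕ κ →₀ ℕ, wdeg m = wdeg m₀ →
      σ (MvPolynomial.coeff m P) = MvPolynomial.coeff m P := fun m hm => by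
    by_cases h : MvPolynomial.coeff m P = 0
    · rw [h, map_zero]
    · apply mul_left_cancel₀ (hprod m)
      rw [htop m hm]
      congr 1
      exact Finset.prod_congr rfl fun i _ => by
        rw [hα m (MvPolynomial.mem_support_iff.2 h) hm i]
  -- In degree zero `P` would be a single monomial in the units `y_i`, which cannot vanish.
  by_cases hd0 : wdeg m₀ = 0
  · exfalso
    have hPm : P = MvPolynomial.monomial m₀ 1 := by
      ext m
      rw [MvPolynomial.coeff_monomial]
      split_ifs with h
      · rw [← h, h1]
      · by_contra hm
        have hm' := MvPolynomial.mem_support_iff.2 hm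
        have hw0 : wdeg m = 0 := by
          have := hd m hm'
          rw [hd0] at this
          exact Nat.le_zero.1 (Nat.cast_le.1 this)
        apply h
        ext v
        rcases v with i | k
        · exact (hα m hm' (hw0.trans hd0.symm) i).symm
        · have e1 := apply_inr_le_wdeg m k
          have e2 := apply_inr_le_wdeg m₀ k
          omega
    have h0 : ev P = 0 := hPI
    rw [hPm, hev, MvPolynomial.aeval_monomial, map_one, one_mul] at h0
    have hu : IsUnit (m₀.prod fun i k => Sum.elim (fun i => (y i : U)) w i ^ k) := by
      refine Finset.prod_induction _ IsUnit (fun _ _ => IsUnit.mul) isUnit_one ?_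
      rintro (i | k) _
      · exact (y i).isUnit.pow _
      · have e2 := apply_inr_le_wdeg m₀ k
        rw [hd0] at e2
        simp [Nat.le_zero.1 e2]
    rw [h0] at hu
    exact not_isUnit_zero hu
  · obtain ⟨k₀, hk₀⟩ := exists_apply_inr_ne_zero hd0
    obtain ⟨S₀, hS₀⟩ := coeff_shift_of_add_one_eq σ a b hd
    set n := m₀ - Finsupp.single (Sum.inr k₀) 1 with hn
    have hnm : n + Finsupp.single (Sum.inr k₀) 1 = m₀ := by
      refine tsub_add_cancel_of_le ?_
      rw [Finsupp.single_le_iff]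
      omega
    have hwn : wdeg m₀ = wdeg n + 1 := by
      conv_lhs => rw [← hnm]
      rw [map_add, wdeg_single_inr]
    have hαn : ∀ i, n (Sum.inl i) = m₀ (Sum.inl i) := fun i => by
      conv_rhs => rw [← hnm]
      simp
    -- The eigenvector equation one degree below the top is the additive relation. Inserting `k₀`
    -- guarantees a nonzero coefficient: there it is `m₀(k₀)`, nonzero in characteristic zero.
    have key := hS₀ (insert k₀ S₀) (Finset.subset_insert _ _) n (by rw [hwn]; push_cast; rfl)
    rw [heig, MvPolynomial.coeff_C_mul] at key
    simp only [hαn] at key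
    have key' := mul_left_cancel₀ (hprod m₀) key
    have hf : ∀ k : κ, σ (MvPolynomial.coeff (n + Finsupp.single (Sum.inr k) 1) P) =
        MvPolynomial.coeff (n + Finsupp.single (Sum.inr k) 1) P := fun k =>
      hfix _ (by rw [map_add, wdeg_single_inr, hwn])
    refine ⟨insert k₀ S₀,
      fun k => MvPolynomial.coeff (n + Finsupp.single (Sum.inr k) 1) P * (n (Sum.inr k) + 1),
      -MvPolynomial.coeff n P, ⟨k₀, Finset.mem_insert_self _ _, ?_⟩, fun k => ?_, ?_⟩
    · simp only
      rw [hnm, h1, one_mul]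
      exact Nat.cast_add_one_ne_zero _
    · rw [map_mul, hf]
      simp
    · rw [map_neg, sub_neg_eq_add, eq_neg_add_iff_add_eq]
      refine Eq.trans ?_ key'.symm
      congr 1
      refine Finset.sum_congr rfl fun k _ => ?_
      simp only [hf]
      ring

end Relations

/-! ### Replacing derivatives by derivatives of logarithmic derivatives. -/

section LogarithmicVariables

/-- A derivation, regarded as a `ℤ`-linear one. -/
def toIntDerivation {A R : Type*} [CommRing A] [CommRing R] [Algebra A R] (D : Derivation A R R) :
    Derivation ℤ R R :=
  Derivation.mk' (D : R →+ R).toIntLinearMap fun f g => D.leibniz f g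

/-- The derivation of `ℤ[Z_0, Z_1, …]` with `Z_n ↦ Z_{n + 1}`. -/
def nextVar : Derivation ℤ (MvPolynomial ℕ ℤ) (MvPolynomial ℕ ℤ) :=
  MvPolynomial.mkDerivation ℤ fun n => MvPolynomial.X (n + 1)

/-- The complete Bell polynomials: the `j`-th derivative of `y` is `y` times the value of
`bell j` at the derivatives of the logarithmic derivative of `y`. -/
def bell : ℕ → MvPolynomial ℕ ℤ
  | 0 => 1
  | j + 1 => nextVar (bell j) + MvPolynomial.X 0 * bell j

variable {R : Type*} [CommRing R] (D : Derivation ℤ R R)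

theorem derivation_aeval_iterate (z : R) (q : MvPolynomial ℕ ℤ) :
    D (MvPolynomial.aeval (fun n => D^[n] z) q) =
      MvPolynomial.aeval (fun n => D^[n] z) (nextVar q) := by
  induction q using MvPolynomial.induction_on with
  | C a => simp [nextVar]
  | add p q hp hq => simp only [map_add, hp, hq]
  | mul_X p n hp =>
    simp only [map_mul, Derivation.leibniz, MvPolynomial.aeval_X, hp, smul_eq_mul, map_add]
    rw [show nextVar (MvPolynomial.X n) = MvPolynomial.X (n + 1) from
      MvPolynomial.mkDerivation_X _ _ _, MvPolynomial.aeval_X, Function.iterate_succ_apply']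

theorem iterate_eq_bell {y z : R} (h : D y = z * y) (j : ℕ) :
    D^[j] y = MvPolynomial.aeval (fun n => D^[n] z) (bell j) * y := by
  induction j with
  | zero => simp [bell]
  | succ j ih =>
    rw [Function.iterate_succ_apply', ih, Derivation.leibniz, derivation_aeval_iterate, h, bell]
    simp only [map_add, map_mul, MvPolynomial.aeval_X, smul_eq_mul, Function.iterate_zero, id]
    ring

variable {ι L : Type*} [Field L] (l : L)

/-- The substitution expressing the derivatives of `y_i` by `y_i` and the elements
`w_{i,n} = l ^ (n + 1) z_i⁽ⁿ⁾`, where `z_i` is the logarithmic derivative of `y_i`. -/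
def logVars : MvPolynomial (ι × ℕ) L →ₐ[L] MvPolynomial (ι ⊕ ι × ℕ) L :=
  MvPolynomial.aeval fun ij => MvPolynomial.aeval
    (fun n => MvPolynomial.C (l⁻¹ ^ (n + 1)) * MvPolynomial.X (Sum.inr (ij.1, n))) (bell ij.2) *
      MvPolynomial.X (Sum.inl ij.1)

theorem aeval_logVars [Algebra L R] (hl : l ≠ 0) {y z : ι → R} (h : ∀ i, D (y i) = z i * y i)
    (P : MvPolynomial (ι × ℕ) L) :
    MvPolynomial.aeval
      (Sum.elim y fun ij : ι × ℕ => algebraMap L R (l ^ (ij.2 + 1)) * D^[ij.2] (z ij.1))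
      (logVars l P) = MvPolynomial.aeval (fun ij : ι × ℕ => D^[ij.2] (y ij.1)) P := by
  suffices hh : (MvPolynomial.aeval (R := L)
      (Sum.elim y fun ij : ι × ℕ => algebraMap L R (l ^ (ij.2 + 1)) * D^[ij.2] (z ij.1))).comp
      (logVars l) = MvPolynomial.aeval (fun ij : ι × ℕ => D^[ij.2] (y ij.1)) from
    DFunLike.congr_fun hh P
  apply MvPolynomial.algHom_ext
  rintro ⟨i, j⟩
  rw [AlgHom.comp_apply, logVars, MvPolynomial.aeval_X, MvPolynomial.aeval_X, map_mul,
    MvPolynomial.aeval_X, iterate_eq_bell D (h i)]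
  simp only [Sum.elim_inl]
  congr 1
  set Φ := MvPolynomial.aeval (R := L)
      (Sum.elim y fun ij : ι × ℕ => algebraMap L R (l ^ (ij.2 + 1)) * D^[ij.2] (z ij.1)) with hΦ
  have := MvPolynomial.comp_aeval_apply (R := ℤ) (B := R)
    (f := fun n => MvPolynomial.C (l⁻¹ ^ (n + 1)) * MvPolynomial.X (Sum.inr (i, n)))
    (φ := (Φ.toRingHom.toIntAlgHom)) (bell j)
  refine this.trans ?_
  congr 2
  funext n
  change Φ _ = _
  rw [map_mul, hΦ, MvPolynomial.aeval_X, MvPolynomial.algHom_C, Sum.elim_inr, ← mul_assoc,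
    ← map_mul, ← mul_pow, inv_mul_cancel₀ hl, one_pow, map_one, one_mul]

/-- Test on generic power series `η_i` whose `j`-th derivative has the indeterminate `Y_{i,j}` as
constant term. By `aeval_logVars` the substituted polynomial takes the value of `P` at the
derivatives of the `η_i`, and the constant term of that is `P` itself. -/
theorem logVars_ne_zero [CharZero L] (hl : l ≠ 0) {P : MvPolynomial (ι × ℕ) L} (hP : P ≠ 0) :
    logVars l P ≠ 0 := by
  intro h0
  let F := FractionRing (MvPolynomial (ι × ℕ) L)
  have : CharZero F := charZero_of_injective_algebraMap (algebraMap L F).injective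
  let η : ι → PowerSeries F := fun i => PowerSeries.mk fun j =>
    algebraMap (MvPolynomial (ι × ℕ) L) F (MvPolynomial.X (i, j)) / (j.factorial : F)
  have hη : ∀ i, PowerSeries.constantCoeff (η i) ≠ 0 := fun i => by
    rw [← PowerSeries.coeff_zero_eq_constantCoeff_apply, PowerSeries.coeff_mk]
    simp [F]
  let D := toIntDerivation (PowerSeries.derivative F)
  have hD : ∀ i, D (η i) = (D (η i) * (η i)⁻¹) * η i := fun i => by
    rw [mul_assoc, PowerSeries.inv_mul_cancel _ (hη i), mul_one]
  have h1 := aeval_logVars D l hl hD P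
  rw [h0, map_zero] at h1
  have h2 := congrArg (PowerSeries.constantCoeff (R := F)) h1
  let Φ : PowerSeries F →ₐ[L] F :=
    { PowerSeries.constantCoeff (R := F) with
      commutes' := fun r => by
        change PowerSeries.constantCoeff (algebraMap L (PowerSeries F) r) = _
        rw [IsScalarTower.algebraMap_apply L F (PowerSeries F)]
        exact PowerSeries.constantCoeff_C _ }
  have h3 := MvPolynomial.comp_aeval_apply (R := L)
    (f := fun ij : ι × ℕ => D^[ij.2] (η ij.1)) (φ := Φ) P
  have h4 : (fun ij : ι × ℕ => Φ (D^[ij.2] (η ij.1))) =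
      fun ij => algebraMap (MvPolynomial (ι × ℕ) L) F (MvPolynomial.X ij) := by
    funext ⟨i, j⟩
    refine (PowerSeries.constantCoeff_iterate_derivative (η i) j).trans ?_
    rw [PowerSeries.coeff_mk]
    have : (j.factorial : F) ≠ 0 := Nat.cast_ne_zero.2 j.factorial_ne_zero
    exact mul_div_cancel₀ _ this
  rw [h4] at h3
  have h5 : algebraMap (MvPolynomial (ι × ℕ) L) F P = 0 := by
    rw [map_zero] at h2
    have h6 := MvPolynomial.comp_aeval_apply (R := L) (f := MvPolynomial.X (R := L))
      (φ := IsScalarTower.toAlgHom L (MvPolynomial (ι × ℕ) L) F) P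
    rw [MvPolynomial.aeval_X_left_apply] at h6
    exact h6.trans (h3.symm.trans h2.symm)
  exact hP ((IsFractionRing.injective (MvPolynomial (ι × ℕ) L) F) (h5.trans (map_zero _).symm))

end LogarithmicVariables

/-! ### Coefficients of coboundaries in `log x`. -/

section LogCoefficients

variable {K : Type*} [Field K] (p : ℕ) [p.AtLeastTwo]

theorem charZero_ratFunc (K : Type*) [Field K] [CharZero K] : CharZero (RatFunc K) :=
  charZero_of_injective_algebraMap (algebraMap K _).injective

/-- The extension of `σ` to power series in `log x` over `K(x)`. -/
def sigmaSeries : PowerSeries (RatFunc K) →+* PowerSeries (RatFunc K) :=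
  (PowerSeries.rescale (p : RatFunc K)).comp
    (PowerSeries.map (sigma K p : RatFunc K →+* RatFunc K))

theorem coeff_sigmaSeries (f : PowerSeries (RatFunc K)) (n : ℕ) :
    PowerSeries.coeff n (sigmaSeries p f) =
      (p : RatFunc K) ^ n * sigma K p (PowerSeries.coeff n f) := by
  simp [sigmaSeries, PowerSeries.coeff_rescale]

theorem sigmaSeries_coe (f : (RatFunc K)[X]) :
    sigmaSeries p (f : PowerSeries (RatFunc K)) = (sigmaLogPoly K p f : (RatFunc K)[X]) := by
  ext n
  rw [coeff_sigmaSeries, Polynomial.coeff_coe, Polynomial.coeff_coe, coeff_sigmaLogPoly, mul_comm]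

/-- If a polynomial in `log x` is a coboundary in `K(x, log x)`, then so is each of its terms, with
a cochain of the form `g (log x) ^ n`. -/
theorem exists_coeff_eq [CharZero K] {h : LogField K} {Q : (RatFunc K)[X]}
    (hQ : sigmaLog K p h - h = algebraMap _ _ Q) (n : ℕ) :
    ∃ g : RatFunc K, Q.coeff n = (p : RatFunc K) ^ n * sigma K p g - g := by
  have := charZero_ratFunc K
  have hp0 : (p : RatFunc K) ≠ 0 := Nat.cast_ne_zero.2 (NeZero.ne p)
  -- Write `h = a / (l^N b₁)` with `b₁(0) ≠ 0`, so that the Laurent expansion of `h` at `l = 0` is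
  -- handled through the power series `a / b₁`.
  obtain ⟨b₁, hb, hb₁⟩ :=
    Polynomial.exists_eq_pow_rootMultiplicity_mul_and_not_dvd h.denom h.denom_ne_zero 0
  rw [C_0, sub_zero] at hb hb₁
  rw [Polynomial.X_dvd_iff] at hb₁
  set N := Polynomial.rootMultiplicity 0 h.denom
  set a := h.num
  have hsX : sigmaLogPoly K p X = (p : (RatFunc K)[X]) * X := by simp [sigmaLogPoly]
  have hpoly : sigmaLogPoly K p a * b₁ - a * ((p : (RatFunc K)[X]) ^ N * sigmaLogPoly K p b₁) =
      Q * ((p : (RatFunc K)[X]) ^ N * X ^ N * b₁ * sigmaLogPoly K p b₁) := by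
    have hb0 : algebraMap _ (LogField K) h.denom ≠ 0 := RatFunc.algebraMap_ne_zero h.denom_ne_zero
    have hsb0 : algebraMap _ (LogField K) (sigmaLogPoly K p h.denom) ≠ 0 :=
      RatFunc.algebraMap_ne_zero fun h0 =>
        h.denom_ne_zero (sigmaLogPoly_injective K p (h0.trans (map_zero _).symm))
    have e : sigmaLogPoly K p a * h.denom - a * sigmaLogPoly K p h.denom =
        Q * (h.denom * sigmaLogPoly K p h.denom) := by
      apply RatFunc.algebraMap_injective (RatFunc K)
      rw [← h.num_div_denom, map_div₀, sigmaLog_poly, sigmaLog_poly, div_sub_div _ _ hsb0 hb0,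
        div_eq_iff (mul_ne_zero hsb0 hb0)] at hQ
      simp only [map_sub, map_mul]
      linear_combination hQ
    have hXN : (X : (RatFunc K)[X]) ^ N ≠ 0 := pow_ne_zero _ X_ne_zero
    apply mul_left_cancel₀ hXN
    rw [hb, map_mul, map_pow, hsX, mul_pow] at e
    linear_combination e
  have hser := congrArg (fun f : (RatFunc K)[X] => (f : PowerSeries (RatFunc K))) hpoly
  simp only [Polynomial.coe_mul, Polynomial.coe_sub, Polynomial.coe_pow, Polynomial.coe_X,
    ← sigmaSeries_coe] at hser
  have hpc : ((p : (RatFunc K)[X]) : PowerSeries (RatFunc K)) = PowerSeries.C (p : RatFunc K) := by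
    rw [← Polynomial.C_eq_natCast, Polynomial.coe_C]
  rw [hpc] at hser
  have hB : PowerSeries.constantCoeff (b₁ : PowerSeries (RatFunc K)) ≠ 0 := by
    rwa [← PowerSeries.coeff_zero_eq_constantCoeff_apply, Polynomial.coeff_coe]
  set B := (b₁ : PowerSeries (RatFunc K))
  set A := (a : PowerSeries (RatFunc K))
  set Q' := (Q : PowerSeries (RatFunc K)) with hQ'
  have hBi : B * B⁻¹ = 1 := PowerSeries.mul_inv_cancel _ hB
  have hsBi : sigmaSeries p B * sigmaSeries p B⁻¹ = 1 := by rw [← map_mul, hBi, map_one]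
  -- Here `A * B⁻¹` is `l^N h`, and the factors `p^N` come from `σ(l^N) = p^N l^N`.
  have key : sigmaSeries p (A * B⁻¹) - PowerSeries.C ((p : RatFunc K) ^ N) * (A * B⁻¹) =
      PowerSeries.C ((p : RatFunc K) ^ N) * (Q' * PowerSeries.X ^ N) := by
    rw [map_mul, map_pow]
    linear_combination (B⁻¹ * sigmaSeries p B⁻¹) * hser
      - sigmaSeries p A * sigmaSeries p B⁻¹ * hBi + PowerSeries.C (p : RatFunc K) ^ N * A * B⁻¹ * hsBi
      + PowerSeries.C (p : RatFunc K) ^ N * Q' * PowerSeries.X ^ N *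
        (sigmaSeries p B * sigmaSeries p B⁻¹ * hBi + hsBi)
  have hc := congrArg (PowerSeries.coeff (n + N)) key
  rw [map_sub, coeff_sigmaSeries, PowerSeries.coeff_C_mul, PowerSeries.coeff_C_mul,
    PowerSeries.coeff_mul_X_pow, hQ', Polynomial.coeff_coe, pow_add] at hc
  refine ⟨PowerSeries.coeff (n + N) (A * B⁻¹), ?_⟩
  apply mul_left_cancel₀ (pow_ne_zero N hp0)
  linear_combination -hc

end LogCoefficients

/-! ### Rescaling and the Euler operator on Laurent series. -/

section Laurent

variable {K : Type*} [Field K]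

/-- The substitution `u ↦ c u` in Laurent series. -/
def rescaleLaurent (c : K) (hc : c ≠ 0) : LaurentSeries K →+* LaurentSeries K where
  toFun f := ⟨fun n => c ^ n * f.coeff n,
    f.isPWO_support'.mono (Function.support_mul_subset_right _ _)⟩
  map_zero' := by ext n; simp
  map_one' := by
    ext n
    simp only [HahnSeries.coeff_one]
    split_ifs with h <;> simp [h]
  map_add' f g := by ext n; simp [mul_add]
  map_mul' f g := by
    ext n
    change c ^ n * (f * g).coeff n = _
    rw [HahnSeries.coeff_mul, HahnSeries.coeff_mul, Finset.mul_sum]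
    refine Finset.sum_congr ?_ ?_
    · ext ij
      simp [Finset.mem_antidiagonal, HahnSeries.mem_support, hc, zpow_ne_zero]
    · intro ij hij
      rw [← (Finset.mem_antidiagonal.1 hij).2.2, zpow_add₀ hc]
      simp only
      ring

theorem coeff_rescaleLaurent (c : K) (hc : c ≠ 0) (f : LaurentSeries K) (n : ℤ) :
    (rescaleLaurent c hc f).coeff n = c ^ n * f.coeff n := rfl

theorem rescaleLaurent_coe (c : K) (hc : c ≠ 0) (f : PowerSeries K) :
    rescaleLaurent c hc (HahnSeries.ofPowerSeries ℤ K f) =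
      HahnSeries.ofPowerSeries ℤ K (PowerSeries.rescale c f) := by
  ext n
  rw [coeff_rescaleLaurent, PowerSeries.coeff_coe, PowerSeries.coeff_coe]
  split_ifs with h
  · simp
  · rw [PowerSeries.coeff_rescale]
    congr 1
    rw [← zpow_natCast]
    congr 1
    omega

/-- The Euler operator `u d/du` on Laurent series. -/
def euler : LaurentSeries K →+ LaurentSeries K where
  toFun f := ⟨fun n => (n : K) * f.coeff n,
    f.isPWO_support'.mono (Function.support_mul_subset_right _ _)⟩
  map_zero' := by ext n; simp
  map_add' f g := by ext n; simp [mul_add]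

theorem coeff_euler (f : LaurentSeries K) (n : ℤ) : (euler f).coeff n = n * f.coeff n := rfl

theorem euler_mul (f g : LaurentSeries K) : euler (f * g) = f * euler g + g * euler f := by
  ext n
  have hs : ∀ f : LaurentSeries K, (euler f).support ⊆ f.support := fun f m hm h => hm (by
    change (m : K) * f.coeff m = 0
    rw [h, mul_zero])
  rw [mul_comm g, coeff_euler, HahnSeries.coeff_add,
    HahnSeries.coeff_mul_right' g.isPWO_support (hs g),
    HahnSeries.coeff_mul_left' f.isPWO_support (hs f), HahnSeries.coeff_mul, Finset.mul_sum,
    ← Finset.sum_add_distrib]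
  refine Finset.sum_congr rfl fun ij hij => ?_
  rw [← (Finset.mem_antidiagonal.1 hij).2.2, coeff_euler, coeff_euler]
  push_cast
  ring

theorem euler_coe (f : PowerSeries K) : euler (HahnSeries.ofPowerSeries ℤ K f) =
    HahnSeries.single 1 1 * HahnSeries.ofPowerSeries ℤ K (PowerSeries.derivative K f) := by
  ext n
  rw [coeff_euler, HahnSeries.coeff_single_mul, PowerSeries.coeff_coe, PowerSeries.coeff_coe,
    one_mul]
  rcases lt_trichotomy n 0 with h | rfl | h
  · rw [if_pos h, if_pos (by omega), mul_zero]
  · simp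
  · rw [if_neg (by omega), if_neg (by omega), PowerSeries.coeff_derivative]
    obtain ⟨m, rfl⟩ : ∃ m : ℕ, n = m + 1 := ⟨(n - 1).natAbs, by omega⟩
    rw [show ((m : ℤ) + 1).natAbs = m + 1 by omega, show ((m : ℤ) + 1 - 1).natAbs = m by omega]
    push_cast
    ring

end Laurent

/-! ### Expansions at `x = α e^u`. -/

section Expansion

variable {K : Type*} [Field K] [CharZero K]

/-- The expansion of polynomials at `x = α e ^ u`. -/
def expandPoly (α : Kˣ) : K[X] →ₐ[K] PowerSeries K :=
  aeval (PowerSeries.C (α : K) * PowerSeries.exp K)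

theorem constantCoeff_expandPoly (α : Kˣ) (q : K[X]) :
    PowerSeries.constantCoeff (expandPoly α q) = q.eval (α : K) := by
  have h := Polynomial.hom_eval₂ q (algebraMap K (PowerSeries K))
    (PowerSeries.constantCoeff (R := K)) (PowerSeries.C (α : K) * PowerSeries.exp K)
  rw [expandPoly, aeval_def, h]
  have : (PowerSeries.constantCoeff (R := K)).comp (algebraMap K (PowerSeries K)) =
      RingHom.id K := by
    ext r
    exact PowerSeries.constantCoeff_C r
  rw [this, Polynomial.eval]
  congr 1
  simp

theorem derivative_expandPoly (α : Kˣ) (q : K[X]) :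
    PowerSeries.derivative K (expandPoly α q) = expandPoly α (X * derivative q) := by
  rw [expandPoly, Derivation.map_aeval, map_mul (aeval _), aeval_X, smul_eq_mul, mul_comm]
  congr 1
  rw [Derivation.leibniz, PowerSeries.derivative_C, PowerSeries.derivative_exp]
  simp

/-- Since `α e^u - α = α u + ⋯`, the factor `x - α` becomes a uniformizer. The value of `v` at `0`
is read off from the derivative. -/
theorem expandPoly_X_sub_C_self (α : Kˣ) : ∃ v : PowerSeries K,
    expandPoly α (X - C (α : K)) = PowerSeries.X * v ∧ PowerSeries.constantCoeff v = α := by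
  have h0 : PowerSeries.constantCoeff (expandPoly α (X - C (α : K))) = 0 := by
    rw [constantCoeff_expandPoly]; simp
  obtain ⟨v, hv⟩ := PowerSeries.X_dvd_iff.2 h0
  refine ⟨v, hv, ?_⟩
  have h1 := congrArg (PowerSeries.constantCoeff (R := K))
    (congrArg (PowerSeries.derivative K) hv)
  rw [derivative_expandPoly, constantCoeff_expandPoly, Derivation.leibniz] at h1
  simpa using h1.symm

theorem expandPoly_ne_zero (α : Kˣ) {q : K[X]} (hq : q ≠ 0) : expandPoly α q ≠ 0 := by
  obtain ⟨q₁, h1, h2⟩ :=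
    Polynomial.exists_eq_pow_rootMultiplicity_mul_and_not_dvd q hq (α : K)
  rw [h1, map_mul, map_pow]
  refine mul_ne_zero (pow_ne_zero _ fun h => ?_) fun h => h2 ?_
  · obtain ⟨v, hv, hv0⟩ := expandPoly_X_sub_C_self α
    rw [h, eq_comm, mul_eq_zero, or_iff_right PowerSeries.X_ne_zero] at hv
    rw [hv, map_zero] at hv0
    exact α.ne_zero hv0.symm
  · rw [Polynomial.dvd_iff_isRoot, Polynomial.IsRoot, ← constantCoeff_expandPoly, h, map_zero]

/-- The expansion of rational functions at `x = α e ^ u`. -/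
def expansion (α : Kˣ) : RatFunc K →+* LaurentSeries K :=
  RatFunc.liftRingHom ((HahnSeries.ofPowerSeries ℤ K).comp (expandPoly α : K[X] →+* _))
    (nonZeroDivisors_le_comap_nonZeroDivisors_of_injective _
      (HahnSeries.ofPowerSeries_injective.comp
        ((injective_iff_map_eq_zero (expandPoly α)).2 fun q hq => by
          by_contra h
          exact expandPoly_ne_zero α h hq)))

theorem expansion_algebraMap (α : Kˣ) (q : K[X]) :
    expansion α (algebraMap _ _ q) = HahnSeries.ofPowerSeries ℤ K (expandPoly α q) :=
  RatFunc.liftRingHom_algebraMap _ _ _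

theorem expansion_algebraMap_const (α : Kˣ) (c : K) :
    expansion α (algebraMap K (RatFunc K) c) = HahnSeries.C c := by
  rw [IsScalarTower.algebraMap_apply K K[X] (RatFunc K), expansion_algebraMap,
    Polynomial.algebraMap_eq, expandPoly, aeval_C]
  exact HahnSeries.ofPowerSeries_C c

theorem coeff_expansion_const_mul (α : Kˣ) (c : K) (f : RatFunc K) (n : ℤ) :
    (expansion α (algebraMap K (RatFunc K) c * f)).coeff n = c * (expansion α f).coeff n := by
  rw [map_mul, expansion_algebraMap_const, HahnSeries.C_mul_eq_smul, HahnSeries.coeff_smul,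
    smul_eq_mul]

/-- The identity behind this is `(α e^u)^p = α^p e^(p u)`. -/
theorem expansion_sigma (p : ℕ) [p.AtLeastTwo] (α : Kˣ) (f : RatFunc K) :
    expansion α (sigma K p f) = rescaleLaurent (p : K) (Nat.cast_ne_zero.2 (NeZero.ne p))
      (expansion (α ^ p) f) := by
  suffices h : (expansion α).comp (sigma K p : RatFunc K →+* RatFunc K) =
      (rescaleLaurent (p : K) (Nat.cast_ne_zero.2 (NeZero.ne p))).comp (expansion (α ^ p)) from
    RingHom.congr_fun h f
  apply IsFractionRing.ringHom_ext (A := K[X])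
  intro q
  change expansion α (sigma K p (algebraMap _ _ q)) =
    rescaleLaurent (p : K) (Nat.cast_ne_zero.2 (NeZero.ne p)) (expansion _ _)
  rw [sigma_algebraMap, expansion_algebraMap, expansion_algebraMap, rescaleLaurent_coe]
  congr 1
  rw [expandPoly, expandPoly, expand_aeval, mul_pow, PowerSeries.exp_pow_eq_rescale_exp]
  have h := Polynomial.hom_eval₂ q (algebraMap K (PowerSeries K))
    (PowerSeries.rescale (p : K)) (PowerSeries.C ((α ^ p : Kˣ) : K) * PowerSeries.exp K)
  have hC : ∀ r : K, PowerSeries.rescale (p : K) (PowerSeries.C r) = PowerSeries.C r := fun r => by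
    ext n
    rw [PowerSeries.coeff_rescale, PowerSeries.coeff_C]
    split_ifs with h0 <;> simp [h0]
  rw [aeval_def, aeval_def, h]
  congr 1
  · ext1 r
    exact (hC r).symm
  · rw [map_mul, hC, ← map_pow]
    simp

theorem coeff_expansion_sigma (p : ℕ) [p.AtLeastTwo] (α : Kˣ) (f : RatFunc K) (n : ℤ) :
    (expansion α (sigma K p f)).coeff n = (p : K) ^ n * (expansion (α ^ p) f).coeff n := by
  rw [expansion_sigma, coeff_rescaleLaurent]

/-- With `x = α e^u` one has `x d/dx = d/du`; the factor `u` turns this into the Euler operator. The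
product rule passes from polynomials to quotients. -/
theorem expansion_partialD (α : Kˣ) (f : RatFunc K) :
    HahnSeries.single 1 1 * expansion α (partialD K f) = euler (expansion α f) := by
  have hpoly : ∀ q : K[X], HahnSeries.single 1 1 * expansion α (partialD K (algebraMap _ _ q)) =
      euler (expansion α (algebraMap _ _ q)) := fun q => by
    rw [partialD, ratDeriv_algebraMap, expansion_algebraMap, expansion_algebraMap, euler_coe,
      derivative_expandPoly]
    rfl
  have hb : algebraMap K[X] (RatFunc K) f.denom ≠ 0 :=
    RatFunc.algebraMap_ne_zero f.denom_ne_zero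
  have hf : f * algebraMap _ _ f.denom = algebraMap _ _ f.num := by
    exact (div_eq_iff hb).1 f.num_div_denom |>.symm
  have h1 := hpoly f.num
  rw [← hf, Derivation.leibniz, map_mul, euler_mul, map_add, smul_eq_mul, smul_eq_mul, map_mul,
    map_mul, ← hpoly] at h1
  apply mul_left_cancel₀ ((map_ne_zero (expansion α)).2 hb)
  linear_combination h1

theorem coeff_expansion_partialD (α : Kˣ) (f : RatFunc K) (n : ℤ) :
    (expansion α (partialD K f)).coeff n = (n + 1) * (expansion α f).coeff (n + 1) := by
  have h := congrArg (fun g : LaurentSeries K => g.coeff (n + 1)) (expansion_partialD α f)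
  simp only [HahnSeries.coeff_single_mul, coeff_euler, add_sub_cancel_right, one_mul] at h
  rw [h]
  push_cast
  ring

/-- Only the residue of `f` reaches this coefficient of the `J`-th derivative in `u`, so higher
polar parts of `f` do not interfere. -/
theorem coeff_expansion_iterate (α : Kˣ) (f : RatFunc K) (J : ℕ) :
    (expansion α ((partialD K)^[J] f)).coeff (-(J + 1 : ℕ) : ℤ) =
      (-1) ^ J * J.factorial * (expansion α f).coeff (-1) := by
  induction J with
  | zero => simp
  | succ J ih =>
    rw [Function.iterate_succ_apply', coeff_expansion_partialD,
      show (-((J + 1 + 1 : ℕ) : ℤ) + 1) = -((J + 1 : ℕ) : ℤ) by push_cast; ring, ih,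
      Nat.factorial_succ]
    push_cast
    ring

theorem coeff_expansion_eq_zero (α : Kˣ) (a b : K[X]) (hb : b.eval (α : K) ≠ 0) {n : ℤ}
    (hn : n < 0) : (expansion α (algebraMap _ _ a / algebraMap _ _ b)).coeff n = 0 := by
  rw [map_div₀, expansion_algebraMap, expansion_algebraMap]
  have hc : PowerSeries.constantCoeff (expandPoly α b) ≠ 0 := by
    rwa [constantCoeff_expandPoly]
  have : HahnSeries.ofPowerSeries ℤ K (expandPoly α a) /
      HahnSeries.ofPowerSeries ℤ K (expandPoly α b) =
      HahnSeries.ofPowerSeries ℤ K (expandPoly α a * (expandPoly α b)⁻¹) := by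
    rw [div_eq_iff, ← map_mul, mul_assoc, PowerSeries.inv_mul_cancel _ hc, mul_one]
    intro h
    rw [map_eq_zero_iff _ HahnSeries.ofPowerSeries_injective] at h
    rw [h, map_zero] at hc
    exact hc rfl
  rw [this, PowerSeries.coeff_coe, if_pos hn]

/-- The logarithmic derivative of `x - β`. -/
def logDeriv (β : K) : RatFunc K :=
  algebraMap K[X] (RatFunc K) X / algebraMap K[X] (RatFunc K) (X - C β)

theorem coeff_expansion_logDeriv [DecidableEq K] (α : Kˣ) (β : K) :
    (expansion α (logDeriv β)).coeff (-1) = if (α : K) = β then 1 else 0 := by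
  split_ifs with h
  · subst h
    obtain ⟨v, hv, hv0⟩ := expandPoly_X_sub_C_self α
    have hv1 : PowerSeries.constantCoeff v ≠ 0 := by rw [hv0]; exact α.ne_zero
    have hne := expandPoly_ne_zero α (X_sub_C_ne_zero (α : K))
    have e : expansion α (logDeriv (α : K)) = HahnSeries.single (-1) 1 *
        HahnSeries.ofPowerSeries ℤ K (expandPoly α X * v⁻¹) := by
      rw [logDeriv, map_div₀, expansion_algebraMap, expansion_algebraMap, div_eq_iff
        (fun h => hne (HahnSeries.ofPowerSeries_injective (h.trans (map_zero _).symm))), hv,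
        mul_assoc, ← map_mul, show expandPoly α X * v⁻¹ * (PowerSeries.X * v) =
          PowerSeries.X * (expandPoly α X * (v⁻¹ * v)) by ring, PowerSeries.inv_mul_cancel _ hv1,
        map_mul, HahnSeries.ofPowerSeries_X, ← mul_assoc, HahnSeries.single_mul_single]
      simp
    rw [e, HahnSeries.coeff_single_mul, one_mul, sub_self]
    rw [show (0 : ℤ) = ((0 : ℕ) : ℤ) from rfl, LaurentSeries.coeff_coe_powerSeries,
      PowerSeries.coeff_zero_eq_constantCoeff_apply, map_mul, constantCoeff_expandPoly,
      PowerSeries.constantCoeff_inv, hv0, eval_X, mul_inv_cancel₀ α.ne_zero]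
  · exact coeff_expansion_eq_zero α _ _ (by simpa [sub_eq_zero] using h) (by norm_num)

theorem finite_coeff_expansion_ne_zero (f : RatFunc K) :
    {α : Kˣ | ∃ n < 0, (expansion α f).coeff n ≠ 0}.Finite := by
  classical
  refine Set.Finite.subset ((f.denom.roots.toFinset.finite_toSet).preimage
    (Units.val_injective.injOn)) ?_
  rintro α ⟨n, hn, hα⟩
  simp only [Set.mem_preimage, Finset.mem_coe, Multiset.mem_toFinset,
    mem_roots f.denom_ne_zero, IsRoot]
  by_contra h
  apply hα
  rw [← f.num_div_denom]
  exact coeff_expansion_eq_zero α _ _ h hn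

end Expansion

/-! ### Residue divisors of logarithmic derivatives, and descent to integer relations. -/

section Divisors

variable {K : Type*} [Field K]

theorem partialD_algebraMap (q : K[X]) : partialD K (algebraMap K[X] (RatFunc K) q) =
    algebraMap _ _ (X * derivative q) := by
  rw [partialD, ratDeriv_algebraMap]
  rfl

theorem partialD_X_sub_C (β : K) : partialD K (algebraMap K[X] (RatFunc K) (X - C β)) =
    algebraMap K[X] (RatFunc K) (X - C β) * logDeriv β := by
  rw [partialD_algebraMap, logDeriv, mul_div_cancel₀ _
    (RatFunc.algebraMap_ne_zero (X_sub_C_ne_zero β))]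
  simp

theorem logDeriv_zero : logDeriv (0 : K) = 1 := by
  rw [logDeriv, C_0, sub_zero]
  exact div_self (RatFunc.algebraMap_ne_zero X_ne_zero)

theorem partialD_prod_X_sub_C (s : Multiset K) :
    partialD K (algebraMap K[X] (RatFunc K) (s.map fun β => X - C β).prod) =
      algebraMap K[X] (RatFunc K) (s.map fun β => X - C β).prod * (s.map logDeriv).sum := by
  induction s using Multiset.induction_on with
  | empty => simp
  | cons β s ih =>
    rw [Multiset.map_cons, Multiset.map_cons, Multiset.prod_cons, Multiset.sum_cons, map_mul,
      Derivation.leibniz, ih, partialD_X_sub_C, smul_eq_mul, smul_eq_mul]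
    ring

/-- The linear combination `∑ n_β x / (x - β)`. -/
def ofDivisor : (K →₀ K) →ₗ[K] RatFunc K := Finsupp.linearCombination K logDeriv

theorem ofDivisor_single (β c : K) : ofDivisor (Finsupp.single β c) = c • logDeriv β :=
  Finsupp.linearCombination_single _ _ _

theorem ofDivisor_multiset [DecidableEq K] (s : Multiset K) :
    ofDivisor ((s.map fun β => Finsupp.single β (1 : K)).sum) = (s.map logDeriv).sum := by
  rw [map_multiset_sum, Multiset.map_map]
  congr 1
  exact Multiset.map_congr rfl fun β _ => by simp [ofDivisor_single]

theorem multiset_sum_single_apply [DecidableEq K] (s : Multiset K) (α : K) :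
    (s.map fun β => Finsupp.single β (1 : K)).sum α = (s.count α : K) := by
  induction s using Multiset.induction_on with
  | empty => simp
  | cons β s ih =>
    rw [Multiset.map_cons, Multiset.sum_cons, Finsupp.add_apply, ih, Multiset.count_cons,
      Finsupp.single_apply]
    by_cases h : β = α
    · simp [h, add_comm]
    · simp [h, Ne.symm h]

theorem exists_divisor_algebraMap [IsAlgClosed K] (q : K[X]) :
    ∃ n : K →₀ K, (∀ β, ∃ m : ℤ, n β = m) ∧ partialD K (algebraMap K[X] (RatFunc K) q) =
      algebraMap K[X] (RatFunc K) q * ofDivisor n := by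
  classical
  refine ⟨(q.roots.map fun β => Finsupp.single β (1 : K)).sum,
    fun β => ⟨q.roots.count β, by rw [multiset_sum_single_apply]; simp⟩, ?_⟩
  have hs := (IsAlgClosed.splits q).eq_prod_roots
  have h := partialD_prod_X_sub_C q.roots
  rw [ofDivisor_multiset]
  conv_lhs => rw [hs]
  conv_rhs => enter [1]; rw [hs]
  rw [map_mul, Derivation.leibniz, h, partialD_algebraMap]
  simp
  ring

/-- The divisor counts zeros minus poles. It takes values in `K`, with integrality recorded
separately, so that it can be combined with coefficients from `K`. -/
theorem exists_divisor [IsAlgClosed K] {a : RatFunc K} (ha : a ≠ 0) :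
    ∃ n : K →₀ K, (∀ β, ∃ m : ℤ, n β = m) ∧ partialD K a / a = ofDivisor n := by
  obtain ⟨n₁, h₁, e₁⟩ := exists_divisor_algebraMap a.num
  obtain ⟨n₂, h₂, e₂⟩ := exists_divisor_algebraMap a.denom
  refine ⟨n₁ - n₂, fun β => ?_, ?_⟩
  · obtain ⟨m₁, hm₁⟩ := h₁ β
    obtain ⟨m₂, hm₂⟩ := h₂ β
    exact ⟨m₁ - m₂, by rw [Finsupp.sub_apply, hm₁, hm₂]; push_cast; rfl⟩
  · have hb : algebraMap K[X] (RatFunc K) a.denom ≠ 0 :=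
      RatFunc.algebraMap_ne_zero a.denom_ne_zero
    have hf : a * algebraMap K[X] (RatFunc K) a.denom = algebraMap _ _ a.num :=
      ((div_eq_iff hb).1 a.num_div_denom).symm
    rw [← hf, Derivation.leibniz, e₂, smul_eq_mul, smul_eq_mul] at e₁
    rw [div_eq_iff ha, map_sub]
    apply mul_left_cancel₀ hb
    linear_combination e₁

/-- The left side `p x^p / (x^p - β)` is the logarithmic derivative of `x^p - β`, which has simple
roots because `β ≠ 0`. -/
theorem mul_sigma_logDeriv [CharZero K] [IsAlgClosed K] [DecidableEq K] (p : ℕ) [p.AtLeastTwo]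
    {β : K} (hβ : β ≠ 0) : ∃ n : K →₀ K, (∀ α, n α = if α ^ p = β then 1 else 0) ∧
      (p : RatFunc K) * sigma K p (logDeriv β) = ofDivisor n := by
  have hp : p ≠ 0 := NeZero.ne p
  set q : K[X] := X ^ p - C β with hq
  have hmonic : q.Monic := monic_X_pow_sub_C β hp
  have hs := (IsAlgClosed.splits q).eq_prod_roots
  rw [hmonic.leadingCoeff, C_1, one_mul] at hs
  refine ⟨(q.roots.map fun β => Finsupp.single β (1 : K)).sum, fun α => ?_, ?_⟩
  · have hnd : q.roots.Nodup :=
      nodup_roots (separable_X_pow_sub_C β (Nat.cast_ne_zero.2 hp) hβ)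
    rw [multiset_sum_single_apply, Multiset.count_eq_of_nodup hnd]
    have hmem : α ∈ q.roots ↔ α ^ p = β := by
      rw [mem_roots hmonic.ne_zero]
      simp [hq, sub_eq_zero]
    simp only [hmem, Nat.cast_ite, Nat.cast_one, Nat.cast_zero]
  · rw [ofDivisor_multiset]
    have h := partialD_prod_X_sub_C q.roots
    rw [← hs, partialD_algebraMap] at h
    rw [logDeriv, map_div₀, sigma_algebraMap, sigma_algebraMap, ← mul_div_assoc]
    have e1 : expand K p (X - C β) = q := by simp [hq]
    rw [e1, div_eq_iff (RatFunc.algebraMap_ne_zero hmonic.ne_zero), mul_comm (Multiset.sum _), ← h,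
      expand_X, ← map_natCast (algebraMap K[X] (RatFunc K)), ← map_mul]
    congr 1
    rw [hq, derivative_sub, derivative_C, sub_zero, derivative_X_pow]
    obtain ⟨m, rfl⟩ := Nat.exists_eq_succ_of_ne_zero hp
    simp
    ring

/-- Away from `0`, take `g` to have divisor `s`: then `p σ(g)` has divisor `α ↦ s(α^p)`. The point
`0` contributes only a constant, since `x / (x - 0) = 1`. -/
theorem exists_coboundary_of_divisor [CharZero K] [IsAlgClosed K] (p : ℕ) [p.AtLeastTwo]
    {n s : K →₀ K} (h : ∀ α ≠ 0, n α = s (α ^ p) - s α) :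
    ∃ g : RatFunc K, ofDivisor n = (p : RatFunc K) * sigma K p g - g := by
  classical
  have hp : p ≠ 0 := NeZero.ne p
  have hp1 : (p : K) - 1 ≠ 0 := by
    have : 2 ≤ p := Nat.AtLeastTwo.prop
    rw [sub_ne_zero]
    exact_mod_cast (by omega : p ≠ 1)
  choose! T hT hT' using fun (β : K) (hβ : β ≠ 0) => mul_sigma_logDeriv p hβ
  set s₀ := s.erase 0 with hs₀
  have hne : ∀ β ∈ s₀.support, β ≠ 0 := fun β hβ h0 => by
    rw [Finsupp.mem_support_iff, h0, hs₀, Finsupp.erase_same] at hβ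
    exact hβ rfl
  set s₁ : K →₀ K := ∑ β ∈ s₀.support, s₀ β • T β with hs₁
  have hs₁a : ∀ α, s₁ α = s₀ (α ^ p) := fun α => by
    rw [hs₁, Finsupp.finsetSum_apply, Finset.sum_congr rfl fun β hβ => by
      rw [Finsupp.smul_apply, hT β (hne β hβ) α, smul_eq_mul, mul_ite, mul_one, mul_zero],
      Finset.sum_ite_eq]
    split_ifs with h
    · rfl
    · exact (Finsupp.notMem_support_iff.1 h).symm
  have hσ : (p : RatFunc K) * sigma K p (ofDivisor s₀) = ofDivisor s₁ := by
    rw [hs₁, map_sum, ofDivisor, Finsupp.linearCombination_apply, Finsupp.sum, map_sum,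
      Finset.mul_sum]
    refine Finset.sum_congr rfl fun β hβ => ?_
    rw [Algebra.smul_def, map_mul, AlgHom.commutes, mul_left_comm, hT' β (hne β hβ), ofDivisor,
      map_smul, Algebra.smul_def]
  have hn : n = s₁ - s₀ + Finsupp.single 0 (n 0) := by
    ext α
    rw [Finsupp.add_apply, Finsupp.sub_apply, hs₁a]
    by_cases hα : α = 0
    · subst hα
      rw [zero_pow hp]
      simp
    · rw [hs₀, Finsupp.erase_ne hα, Finsupp.erase_ne (pow_ne_zero p hα), h α hα,
        Finsupp.single_apply, if_neg (Ne.symm hα), add_zero]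
  -- A constant `e` has coboundary `(p - 1) e`, which dictates the correction at `0`.
  refine ⟨ofDivisor s₀ + algebraMap K _ (n 0 / (p - 1)), ?_⟩
  conv_lhs => rw [hn]
  have hc : (p : RatFunc K) * algebraMap K (RatFunc K) (n 0 / (p - 1)) -
      algebraMap K (RatFunc K) (n 0 / (p - 1)) = algebraMap K _ (n 0) := by
    rw [← map_natCast (algebraMap K (RatFunc K)), ← map_mul, ← map_sub]
    congr 1
    field_simp
  rw [map_add, map_sub, ofDivisor_single, logDeriv_zero, ← Algebra.algebraMap_eq_smul_one,
    map_add, AlgHom.commutes, ← hc, ← hσ]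
  ring

theorem coeff_expansion_ofDivisor [CharZero K] (α : Kˣ) (n : K →₀ K) :
    (expansion α (ofDivisor n)).coeff (-1) = n α := by
  classical
  induction n using Finsupp.induction_linear with
  | zero => simp
  | add f g hf hg => rw [map_add, map_add, HahnSeries.coeff_add, hf, hg, Finsupp.add_apply]
  | single β c =>
    rw [ofDivisor_single, Algebra.smul_def, coeff_expansion_const_mul, coeff_expansion_logDeriv,
      Finsupp.single_apply]
    simp [eq_comm]

/-- Compare coefficients of `u^(-(J+1))` at each `α`: rescaling by `p` contributes `p^(-(J+1))`,
cancelling the factor `p^(J+1)`. Up to `(-1)^J J!`, `s` is the polar coefficient of `g`, nonzero at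
finitely many points only. -/
theorem exists_divisor_coboundary [CharZero K] (p : ℕ) [p.AtLeastTwo] {n : K →₀ K} {J : ℕ}
    {g : RatFunc K} (h : (partialD K)^[J] (ofDivisor n) =
      (p : RatFunc K) ^ (J + 1) * sigma K p g - g) :
    ∃ s : K →₀ K, ∀ α ≠ 0, n α = s (α ^ p) - s α := by
  have hp : (p : K) ≠ 0 := Nat.cast_ne_zero.2 (NeZero.ne p)
  set e : K := (-1) ^ J * J.factorial with he
  have he0 : e ≠ 0 := mul_ne_zero (pow_ne_zero _ (by simp)) (Nat.cast_ne_zero.2 J.factorial_ne_zero)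
  let r : Kˣ → K := fun α => e⁻¹ * (expansion α g).coeff (-(J + 1 : ℕ) : ℤ)
  have hr : (Function.support r).Finite :=
    (finite_coeff_expansion_ne_zero g).subset fun α hα =>
      ⟨-(J + 1 : ℕ), by omega, fun h0 => hα (by simp only [r]; rw [h0, mul_zero])⟩
  let s : K →₀ K := (Finsupp.ofSupportFinite r hr).embDomain ⟨Units.val, Units.val_injective⟩
  have hs : ∀ α : Kˣ, s α = r α := fun α =>
    Finsupp.embDomain_apply_self ⟨Units.val, Units.val_injective⟩ (Finsupp.ofSupportFinite r hr) α
  refine ⟨s, fun α hα => ?_⟩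
  lift α to Kˣ using hα.isUnit
  rw [← Units.val_pow_eq_pow_val, hs, hs]
  have h1 := congrArg (fun f => (expansion α f).coeff (-(J + 1 : ℕ) : ℤ)) h
  rw [coeff_expansion_iterate, coeff_expansion_ofDivisor, ← he, map_sub, HahnSeries.coeff_sub,
    ← map_natCast (algebraMap K (RatFunc K)), ← map_pow, coeff_expansion_const_mul,
    coeff_expansion_sigma, zpow_neg, zpow_natCast, ← mul_assoc, mul_inv_cancel₀ (pow_ne_zero _ hp),
    one_mul] at h1
  simp only [r]
  rw [← mul_sub, ← h1, inv_mul_cancel_left₀ he0]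

/-- A nontrivial linear relation over `K` between divisors with integer coefficients, modulo
coboundaries, implies one over `ℤ`. -/
theorem exists_int_relation [CharZero K] (p : ℕ) {t : ℕ} {n : Fin t → K →₀ K}
    (hn : ∀ i β, ∃ m : ℤ, n i β = m) {c : Fin t → K} (hc : c ≠ 0) {s : K →₀ K}
    (h : ∀ α ≠ 0, (∑ i, c i • n i) α = s (α ^ p) - s α) :
    ∃ (k : Fin t → ℤ) (s' : K →₀ K), k ≠ 0 ∧
      ∀ α ≠ 0, (∑ i, (k i : K) • n i) α = s' (α ^ p) - s' α := by
  obtain ⟨i₀, hi₀⟩ := Function.ne_iff.1 hc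
  -- Apply `φ`, multiplied by a common denominator `N`, to the relation. It commutes with the
  -- integer values of the `n i`, so each `c i` becomes the integer `N φ(c i)`.
  obtain ⟨φ, hφ⟩ : ∃ φ : Module.Dual ℚ K, φ (c i₀) ≠ 0 := by
    by_contra! hall
    exact hi₀ ((Module.forall_dual_apply_eq_zero_iff ℚ (c i₀)).1 hall)
  obtain ⟨N, hN⟩ := IsLocalization.exist_integer_multiples_of_finite (nonZeroDivisors ℤ)
    (fun i => φ (c i))
  choose k hk using hN
  have hN0 : ((N : ℤ) : ℚ) ≠ 0 := Int.cast_ne_zero.2 (nonZeroDivisors.coe_ne_zero N)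
  have hk' : ∀ i, (k i : ℚ) = (N : ℤ) * φ (c i) := fun i => by
    have := hk i
    rwa [zsmul_eq_mul] at this
  let ψ : K →+ K := (algebraMap ℚ K : ℚ →+ K).comp ((AddMonoidHom.mulLeft ((N : ℤ) : ℚ)).comp
    φ.toAddMonoidHom)
  have hψ : ∀ x, ψ x = algebraMap ℚ K ((N : ℤ) * φ x) := fun x => rfl
  refine ⟨k, s.mapRange ψ (map_zero ψ), fun h0 => ?_, fun α hα => ?_⟩
  · have := hk' i₀
    rw [h0, Pi.zero_apply, Int.cast_zero] at this
    exact mul_ne_zero hN0 hφ this.symm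
  · rw [Finsupp.mapRange_apply, Finsupp.mapRange_apply, ← map_sub, ← h α hα]
    simp only [Finsupp.finsetSum_apply, Finsupp.smul_apply, smul_eq_mul, map_sum]
    refine Finset.sum_congr rfl fun i _ => ?_
    obtain ⟨m, hm⟩ := hn i α
    rw [hm, mul_comm (c i), ← zsmul_eq_mul (c i), map_zsmul, hψ, ← hk', zsmul_eq_mul, mul_comm]
    simp

/-- The key descent: a `K`-linear relation between derivatives of logarithmic derivatives modulo
coboundaries gives a `ℤ`-linear relation between the logarithmic derivatives. -/
theorem exists_int_coboundary [CharZero K] [IsAlgClosed K] (p : ℕ) [p.AtLeastTwo] {t : ℕ}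
    {a : Fin t → RatFunc K} (ha : ∀ i, a i ≠ 0) {c : Fin t → K} (hc : c ≠ 0) {J : ℕ}
    {g : RatFunc K} (h : (partialD K)^[J] (∑ i, c i • (partialD K (a i) / a i)) =
      (p : RatFunc K) ^ (J + 1) * sigma K p g - g) :
    ∃ (k : Fin t → ℤ) (g : RatFunc K), k ≠ 0 ∧
      ∑ i, (k i : RatFunc K) * (partialD K (a i) / a i) = (p : RatFunc K) * sigma K p g - g := by
  choose n hn hb using fun i => exists_divisor (ha i)
  simp only [hb, ← map_smul, ← map_sum] at h
  obtain ⟨s, hs⟩ := exists_divisor_coboundary p h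
  obtain ⟨k, s', hk, hs'⟩ := exists_int_relation p hn hc hs
  obtain ⟨g', hg'⟩ := exists_coboundary_of_divisor p hs'
  refine ⟨k, g', hk, ?_⟩
  rw [← hg', map_sum]
  refine Finset.sum_congr rfl fun i _ => ?_
  rw [hb, map_smul, Algebra.smul_def, map_intCast]

end Divisors

/-! ### Logarithmic derivatives of products. -/

section LogarithmicDerivative

variable {A L : Type*} [CommRing A] [Field L] [Algebra A L]

/-- The logarithmic derivative as a homomorphism. -/
def dlog (D : Derivation A L L) : Lˣ →* Multiplicative L :=
  MonoidHom.mk' (fun u => Multiplicative.ofAdd (D u / u)) fun u v => by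
    rw [← ofAdd_add]
    congr 1
    have hu := u.ne_zero
    have hv := v.ne_zero
    rw [Units.val_mul, Derivation.leibniz, smul_eq_mul, smul_eq_mul]
    field_simp
    ring

theorem derivation_prod_zpow (D : Derivation A L L) {ι : Type*} [Fintype ι] {a : ι → L}
    (ha : ∀ i, a i ≠ 0) (k : ι → ℤ) :
    D (∏ i, a i ^ k i) / ∏ i, a i ^ k i = ∑ i, (k i : L) * (D (a i) / a i) := by
  have h := congrArg Multiplicative.toAdd
    (map_prod (dlog D) (fun i => Units.mk0 (a i) (ha i) ^ k i) Finset.univ)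
  rw [toAdd_prod] at h
  simp only [map_zpow, toAdd_zpow] at h
  have h' : ((∏ i, Units.mk0 (a i) (ha i) ^ k i : Lˣ) : L) = ∏ i, a i ^ k i := by
    simp [Units.coe_prod]
  rw [← h']
  refine h.trans (Finset.sum_congr rfl fun i _ => ?_)
  rw [zsmul_eq_mul]
  rfl

end LogarithmicDerivative

/-! ### The action of `σ` on derivatives of `∂y / y`. -/

namespace SigmaPartialAlgebra

variable {K : Type*} [Field K] [CharZero K] {p : ℕ} [p.AtLeastTwo]
  {U : Type*} [CommRing U] [Algebra (LogField K) U] (S : SigmaPartialAlgebra K p U)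

/-- The logarithmic derivative of a unit. -/
def logDer (y : Uˣ) : U := S.d y * (y⁻¹ : Uˣ)

theorem d_eq_logDer_mul (y : Uˣ) : S.d y = S.logDer y * y := by
  rw [logDer, mul_assoc, Units.inv_mul, mul_one]

-- The commutation rule on `K(x, log x)` is inherited from `U`, into which this field embeds.
include S in
theorem partialLog_sigmaLog [Nontrivial U] (f : LogField K) :
    partialLog K (sigmaLog K p f) = p * sigmaLog K p (partialLog K f) := by
  apply (algebraMap (LogField K) U).injective
  rw [← S.d_algebraMap, ← S.σ_algebraMap, S.d_σ, S.d_algebraMap, S.σ_algebraMap, map_mul,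
    map_natCast]

variable [Algebra (RatFunc K) U] [IsScalarTower (RatFunc K) (LogField K) U]

theorem σ_ratFunc (f : RatFunc K) :
    S.σ (algebraMap (RatFunc K) U f) = algebraMap (RatFunc K) U (sigma K p f) := by
  rw [IsScalarTower.algebraMap_apply (RatFunc K) (LogField K) U, S.σ_algebraMap,
    sigmaLog_algebraMap, ← IsScalarTower.algebraMap_apply]

theorem d_ratFunc (f : RatFunc K) :
    S.d (algebraMap (RatFunc K) U f) = algebraMap (RatFunc K) U (partialD K f) := by
  rw [IsScalarTower.algebraMap_apply (RatFunc K) (LogField K) U, S.d_algebraMap,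
    partialLog_algebraMap, ← IsScalarTower.algebraMap_apply]

variable {a : RatFunc K} (ha : a ≠ 0) {y : Uˣ} (hy : S.σ y = algebraMap (RatFunc K) U a * y)

-- Differentiate `σ y = a y` and cancel the unit `a y`.
include ha hy in
theorem mul_σ_logDer :
    p * S.σ (S.logDer y) = S.logDer y + algebraMap (RatFunc K) U (partialD K a / a) := by
  have h1 := S.d_σ y
  rw [hy, Derivation.leibniz, S.d_ratFunc, smul_eq_mul, smul_eq_mul, S.d_eq_logDer_mul,
    map_mul S.σ, hy] at h1
  have hu : IsUnit (algebraMap (RatFunc K) U a * y) :=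
    ((IsUnit.mk0 a ha).map (algebraMap (RatFunc K) U)).mul y.isUnit
  apply hu.mul_right_cancel
  have h2 : algebraMap (RatFunc K) U (partialD K a / a) * algebraMap (RatFunc K) U a =
      algebraMap (RatFunc K) U (partialD K a) := by
    rw [← map_mul, div_mul_cancel₀ _ ha]
  linear_combination -h1 - y * h2

include ha hy in
theorem mul_σ_iterate_logDer (j : ℕ) :
    (p : U) ^ (j + 1) * S.σ (S.d^[j] (S.logDer y)) = S.d^[j] (S.logDer y) +
      algebraMap (RatFunc K) U ((partialD K)^[j] (partialD K a / a)) := by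
  induction j with
  | zero => simpa using S.mul_σ_logDer ha hy
  | succ j ih =>
    have h := congrArg S.d ih
    rw [map_add, S.d_ratFunc, ← Nat.cast_pow, Derivation.leibniz, Derivation.map_natCast, smul_zero,
      add_zero, S.d_σ, smul_eq_mul] at h
    rw [Function.iterate_succ_apply', Function.iterate_succ_apply', ← h]
    push_cast
    ring

end SigmaPartialAlgebra

/-! ### From differential dependence to a coboundary relation. -/

section Forward

variable {K : Type*} [Field K]

theorem algebraMap_C_mul_X_pow (f : RatFunc K) (n : ℕ) :
    algebraMap (RatFunc K)[X] (LogField K) (C f * X ^ n) =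
      algebraMap (RatFunc K) (LogField K) f * logX K ^ n := by
  rw [map_mul, map_pow, logX, RatFunc.algebraMap_X, RatFunc.algebraMap_C, RatFunc.algebraMap_eq_C]

theorem logX_ne_zero : logX K ≠ 0 := RatFunc.X_ne_zero

variable [CharZero K] {p : ℕ} [p.AtLeastTwo]

theorem exists_coboundary_of_prod_zpow
    (hcomm : ∀ f, partialLog K (sigmaLog K p f) = p * sigmaLog K p (partialLog K f))
    {t : ℕ} {a : Fin t → RatFunc K} (ha : ∀ i, a i ≠ 0) {k : Fin t → ℤ} {h : LogField K}
    (hh : h ≠ 0)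
    (hk : ∏ i, algebraMap (RatFunc K) (LogField K) (a i) ^ k i = sigmaLog K p h / h) :
    ∃ g : RatFunc K, ∑ i, (k i : RatFunc K) * (partialD K (a i) / a i) =
      (p : RatFunc K) * sigma K p g - g := by
  set b := ∑ i, (k i : RatFunc K) * (partialD K (a i) / a i) with hb
  have hσh : sigmaLog K p h ≠ 0 := (_root_.map_ne_zero _).2 hh
  have h1 := derivation_prod_zpow (partialLog K)
    (fun i => (_root_.map_ne_zero (algebraMap (RatFunc K) (LogField K))).2 (ha i)) k
  rw [hk] at h1
  have h2 : ∑ i, (k i : LogField K) * (partialLog K (algebraMap (RatFunc K) (LogField K) (a i)) /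
      algebraMap (RatFunc K) (LogField K) (a i)) = algebraMap (RatFunc K) (LogField K) b := by
    simp only [hb, map_sum, map_mul, map_div₀, map_intCast, partialLog_algebraMap]
  rw [h2, Derivation.leibniz_div, hcomm, smul_eq_mul, smul_eq_mul, smul_eq_mul] at h1
  -- Logarithmic differentiation of `∏ a_i^(k_i) = σh / h` gives `b = p σ(∂h/h) - ∂h/h`. Multiplying
  -- by `log x` absorbs the `p` and makes `b log x` a genuine coboundary.
  obtain ⟨g, hg⟩ := exists_coeff_eq p (h := logX K * (partialLog K h / h)) (Q := C b * X ^ 1) (by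
    rw [map_mul, map_div₀, sigmaLog_logX, algebraMap_C_mul_X_pow, ← h1]
    field_simp) 1
  refine ⟨g, ?_⟩
  simpa using hg

theorem exists_iterate_coboundary {t : ℕ} {b : Fin t → RatFunc K} {S : Finset (Fin t × ℕ)}
    {c : Fin t × ℕ → K} {k₀ : Fin t × ℕ} (hk₀ : k₀ ∈ S) (hc : c k₀ ≠ 0) {h : LogField K}
    (hh : ∑ k ∈ S, algebraMap K (LogField K) (c k) * (logX K ^ (k.2 + 1) *
      algebraMap (RatFunc K) (LogField K) ((partialD K)^[k.2] (b k.1))) = sigmaLog K p h - h) :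
    ∃ (c' : Fin t → K) (g : RatFunc K), c' ≠ 0 ∧
      (partialD K)^[k₀.2] (∑ i, c' i • b i) = (p : RatFunc K) ^ (k₀.2 + 1) * sigma K p g - g := by
  classical
  set J := k₀.2
  -- Only the pairs with second entry `J` contribute to the coefficient of `l^(J+1)`; choosing `J =
  -- k₀.2` keeps `c k₀` among them.
  let c' : Fin t → K := fun i => if (i, J) ∈ S then c (i, J) else 0
  obtain ⟨g, hg⟩ := exists_coeff_eq p (h := h)
    (Q := ∑ k ∈ S, C (algebraMap K (RatFunc K) (c k) * (partialD K)^[k.2] (b k.1)) *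
      X ^ (k.2 + 1)) (by
    rw [← hh, map_sum]
    refine Finset.sum_congr rfl fun k _ => ?_
    rw [algebraMap_C_mul_X_pow, map_mul, ← IsScalarTower.algebraMap_apply]
    ring) (J + 1)
  refine ⟨c', g, Function.ne_iff.2 ⟨k₀.1, ?_⟩, hg.symm.trans ?_ |>.symm⟩
  · simp only [c', Pi.zero_apply, J]
    rwa [if_pos (by simpa using hk₀)]
  · have hlin : ∀ j f, (partialD K)^[j] f = ((partialD K : RatFunc K →ₗ[K] RatFunc K) ^ j) f :=
      fun j f => by rw [Module.End.pow_apply]; rfl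
    simp only [Polynomial.finsetSum_coeff, coeff_C_mul, coeff_X_pow, hlin, map_sum,
      mul_ite, mul_one, mul_zero]
    have h1 : ∀ i, ((partialD K : RatFunc K →ₗ[K] RatFunc K) ^ J) (c' i • b i) =
        if (i, J) ∈ S then algebraMap K (RatFunc K) (c (i, J)) *
          ((partialD K : RatFunc K →ₗ[K] RatFunc K) ^ J) (b i) else 0 := fun i => by
      simp only [c']
      split_ifs
      · rw [map_smul, Algebra.smul_def]
      · rw [zero_smul, map_zero]
    simp only [h1]
    rw [← Finset.sum_filter, ← Finset.sum_filter]
    refine Finset.sum_bij' (fun k _ => k.1) (fun i _ => (i, J)) ?_ ?_ ?_ ?_ ?_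
    · rintro ⟨i, j⟩ hk
      simp only [Finset.mem_filter, add_left_inj] at hk
      obtain ⟨hk, rfl⟩ := hk
      simpa using hk
    · intro i hi
      simpa using hi
    · rintro ⟨i, j⟩ hk
      simp only [Finset.mem_filter, add_left_inj] at hk
      rw [hk.2]
    · intro i _; rfl
    · rintro ⟨i, j⟩ hk
      simp only [Finset.mem_filter, add_left_inj] at hk
      rw [hk.2]

theorem exists_coboundary_of_diffDependent [IsAlgClosed K]
    {U : Type*} [CommRing U] [Nontrivial U] [Algebra (LogField K) U]
    [Algebra (RatFunc K) U] [IsScalarTower (RatFunc K) (LogField K) U]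
    [Algebra K U] [IsScalarTower K (LogField K) U] (S : SigmaPartialAlgebra K p U)
    (hU : {u : U | S.σ u = u} = Set.range (algebraMap K U))
    {t : ℕ} {a : Fin t → RatFunc K} (ha : ∀ i, a i ≠ 0)
    {y : Fin t → Uˣ} (hy : ∀ i, S.σ (y i) = algebraMap (RatFunc K) U (a i) * y i)
    (hdep : DiffDependent (RatFunc K) S.d (fun i => (y i : U))) :
    ∃ (k : Fin t → ℤ) (g : RatFunc K), k ≠ 0 ∧
      ∑ i, (k i : RatFunc K) * (partialD K (a i) / a i) = (p : RatFunc K) * sigma K p g - g := by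
  obtain ⟨P, hP0, hP⟩ := hdep
  have : CharZero (RatFunc K) := charZero_ratFunc K
  have : CharZero (LogField K) := charZero_ratFunc (RatFunc K)
  have hQ0 := logVars_ne_zero (logX K) logX_ne_zero (P := MvPolynomial.map
    (algebraMap (RatFunc K) (LogField K)) P) fun h => hP0
      (MvPolynomial.map_injective _ (algebraMap (RatFunc K) (LogField K)).injective
        (h.trans (map_zero _).symm))
  have hQ := aeval_logVars S.d (logX K) logX_ne_zero (fun i => S.d_eq_logDer_mul (y i))
    (MvPolynomial.map (algebraMap (RatFunc K) (LogField K)) P)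
  rw [MvPolynomial.aeval_map_algebraMap, hP] at hQ
  have hw : ∀ ij : Fin t × ℕ,
      S.σ (algebraMap (LogField K) U (logX K ^ (ij.2 + 1)) * S.d^[ij.2] (S.logDer (y ij.1))) =
        algebraMap (LogField K) U (logX K ^ (ij.2 + 1)) * S.d^[ij.2] (S.logDer (y ij.1)) +
          algebraMap (LogField K) U (logX K ^ (ij.2 + 1) * algebraMap (RatFunc K) (LogField K)
            ((partialD K)^[ij.2] (partialD K (a ij.1) / a ij.1))) := fun ij => by
    have h := S.mul_σ_iterate_logDer (ha ij.1) (hy ij.1) ij.2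
    rw [map_mul, S.σ_algebraMap, map_pow, sigmaLog_logX, mul_pow, map_mul (algebraMap _ U),
      map_pow (algebraMap _ U) (p : LogField K), map_natCast, map_mul (algebraMap _ U),
      ← IsScalarTower.algebraMap_apply (RatFunc K) (LogField K) U]
    linear_combination algebraMap (LogField K) U (logX K ^ (ij.2 + 1)) * h
  rcases relation_of_dependent (sigmaLog K p)
    (fun i => algebraMap (RatFunc K) (LogField K) (a i)) _ (fun i => (_root_.map_ne_zero _).2 (ha i))
    S.σ S.σ_algebraMap y (fun i => by rw [hy, IsScalarTower.algebraMap_apply (RatFunc K)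
      (LogField K) U]) _ hw hQ0 hQ with ⟨k, hk, h, hh, e⟩ | ⟨T, c, h, ⟨k₀, hk₀, hck₀⟩, hc, e⟩
  · obtain ⟨g, hg⟩ := exists_coboundary_of_prod_zpow S.partialLog_sigmaLog ha hh e
    exact ⟨k, g, hk, hg⟩
  -- Here the hypothesis on `U^σ` enters: coefficients fixed by `σ` lie in `K`.
  · have hconst : ∀ k, ∃ c' : K, algebraMap K (LogField K) c' = c k := fun k => by
      have h1 : algebraMap (LogField K) U (c k) ∈ {u : U | S.σ u = u} := by
        rw [Set.mem_ofPred_eq, S.σ_algebraMap, hc]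
      rw [hU] at h1
      obtain ⟨c', hc'⟩ := h1
      refine ⟨c', (algebraMap (LogField K) U).injective ?_⟩
      rw [← hc', ← IsScalarTower.algebraMap_apply]
    choose c₀ hc₀ using hconst
    simp only [← hc₀] at e
    obtain ⟨c', g, hc', hg⟩ := exists_iterate_coboundary
      (b := fun i => partialD K (a i) / a i) (c := c₀) hk₀
      (fun h0 => hck₀ (by rw [← hc₀, h0, map_zero])) e
    exact exists_int_coboundary p ha hc' hg

end Forward

/-! ### From a coboundary relation to a differential equation over `K(x)`. -/

section Backward

variable {F : Type*} [Field F] {t : ℕ}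

/-- The differential polynomial `(∏ Y_j) (∑ k_i Y_i' / Y_i - g)`. -/
def logDerPoly (k : Fin t → ℤ) (g : F) : MvPolynomial (Fin t × ℕ) F :=
  ∑ i, (k i : MvPolynomial (Fin t × ℕ) F) * (MvPolynomial.X (i, 1) *
    ∏ j ∈ Finset.univ.erase i, MvPolynomial.X (j, 0)) -
      MvPolynomial.C g * ∏ j, MvPolynomial.X (j, 0)

/-- The differential polynomial `(∏ Y_j) ^ 2 (∑ k_i (Y_i' / Y_i)' - g')`. -/
def logDerPoly' (k : Fin t → ℤ) (g' : F) : MvPolynomial (Fin t × ℕ) F :=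
  ∑ i, (k i : MvPolynomial (Fin t × ℕ) F) * ((MvPolynomial.X (i, 2) * MvPolynomial.X (i, 0) -
    MvPolynomial.X (i, 1) ^ 2) * (∏ j ∈ Finset.univ.erase i, MvPolynomial.X (j, 0)) ^ 2) -
      MvPolynomial.C g' * (∏ j, MvPolynomial.X (j, 0)) ^ 2

theorem logDerPoly_sq_add_ne_zero [CharZero F] {k : Fin t → ℤ} (hk : k ≠ 0) (g g' c : F) :
    logDerPoly k g ^ 2 + MvPolynomial.C c * logDerPoly' k g' ≠ 0 := by
  intro h
  obtain ⟨i₀, hi₀⟩ := Function.ne_iff.1 hk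
  have hk₀ : (k i₀ : F) ≠ 0 := Int.cast_ne_zero.2 hi₀
  set u : F := (g + 1) / k i₀ with hu
  set m : F := u ^ 2 + g' / k i₀ with hm
  -- At this point all `Y_j` are `1` and only `Y_{i₀}` has nonzero derivatives. The value `u` makes
  -- `logDerPoly` equal to `1`, and `m` makes `logDerPoly'` vanish, so `c` plays no role.
  let v : Fin t × ℕ → F := fun ij => match ij.2 with
    | 0 => 1
    | 1 => if ij.1 = i₀ then u else 0
    | _ => if ij.1 = i₀ then m else 0
  have h1 := congrArg (MvPolynomial.eval v) h
  have e1 : MvPolynomial.eval v (logDerPoly k g) = 1 := by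
    simp only [logDerPoly, map_sub, map_sum, map_mul, map_prod, MvPolynomial.eval_X,
      MvPolynomial.eval_C, map_intCast, v, Finset.prod_const_one, mul_one, mul_ite, mul_zero,
      Finset.sum_ite_eq', Finset.mem_univ, if_true]
    rw [hu]
    field_simp
    ring
  have e2 : MvPolynomial.eval v (logDerPoly' k g') = 0 := by
    simp only [logDerPoly', map_sub, map_sum, map_mul, map_prod, map_pow, MvPolynomial.eval_X,
      MvPolynomial.eval_C, map_intCast, v, Finset.prod_const_one, mul_one, one_pow]
    rw [Finset.sum_eq_single i₀ (fun j _ hj => by simp [hj]) (by simp)]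
    simp only [if_true, hm]
    field_simp
    ring
  rw [map_add, map_pow, map_mul, e1, e2] at h1
  simp at h1

variable {U : Type*} [CommRing U] [Algebra F U] (D : Derivation ℤ U U) {y z : Fin t → U}
  (hz : ∀ i, D (y i) = z i * y i)

include hz in
theorem aeval_logDerPoly (k : Fin t → ℤ) (g : F) :
    MvPolynomial.aeval (fun ij : Fin t × ℕ => D^[ij.2] (y ij.1)) (logDerPoly k g) =
      (∑ i, (k i : U) * z i - algebraMap F U g) * ∏ j, y j := by
  simp only [logDerPoly, map_sub, map_sum, map_mul, map_prod, MvPolynomial.aeval_X,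
    MvPolynomial.algHom_C, map_intCast, Function.iterate_zero, Function.iterate_one, id, sub_mul,
    Finset.sum_mul]
  congr 1
  refine Finset.sum_congr rfl fun i _ => ?_
  rw [hz, ← Finset.mul_prod_erase _ _ (Finset.mem_univ i)]
  ring

include hz in
theorem aeval_logDerPoly' (k : Fin t → ℤ) (g' : F) :
    MvPolynomial.aeval (fun ij : Fin t × ℕ => D^[ij.2] (y ij.1)) (logDerPoly' k g') =
      (∑ i, (k i : U) * D (z i) - algebraMap F U g') * (∏ j, y j) ^ 2 := by
  simp only [logDerPoly', map_sub, map_sum, map_mul, map_prod, map_pow, MvPolynomial.aeval_X,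
    MvPolynomial.algHom_C, map_intCast, Function.iterate_zero, Function.iterate_succ,
    Function.comp_apply, id, sub_mul, Finset.sum_mul]
  congr 1
  refine Finset.sum_congr rfl fun i _ => ?_
  rw [hz, Derivation.leibniz, hz, ← Finset.mul_prod_erase _ _ (Finset.mem_univ i), smul_eq_mul,
    smul_eq_mul]
  ring

theorem diffDependent_of_coboundary {K : Type*} [Field K] [CharZero K] {p : ℕ} [p.AtLeastTwo]
    {U : Type*} [CommRing U] [Algebra (LogField K) U]
    [Algebra (RatFunc K) U] [IsScalarTower (RatFunc K) (LogField K) U]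
    [Algebra K U] [IsScalarTower K (LogField K) U] (S : SigmaPartialAlgebra K p U)
    (hU : {u : U | S.σ u = u} = Set.range (algebraMap K U))
    {t : ℕ} {a : Fin t → RatFunc K} (ha : ∀ i, a i ≠ 0)
    {y : Fin t → Uˣ} (hy : ∀ i, S.σ (y i) = algebraMap (RatFunc K) U (a i) * y i)
    {k : Fin t → ℤ} {g : RatFunc K} (hk : k ≠ 0)
    (h : ∑ i, (k i : RatFunc K) * (partialD K (a i) / a i) = (p : RatFunc K) * sigma K p g - g) :
    DiffDependent (RatFunc K) S.d (fun i => (y i : U)) := by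
  have : CharZero (RatFunc K) := charZero_ratFunc K
  set w : U := ∑ i, (k i : U) * S.logDer (y i) - algebraMap (RatFunc K) U g with hw
  have hσw : p * S.σ w = w := by
    have h1 := congrArg (algebraMap (RatFunc K) U) h
    simp only [map_sum, map_mul, map_intCast, map_sub, map_natCast] at h1
    rw [hw, map_sub, map_sum, S.σ_ratFunc, mul_sub, Finset.mul_sum]
    have h2 : ∀ i, p * S.σ ((k i : U) * S.logDer (y i)) = (k i : U) * S.logDer (y i) +
        (k i : U) * algebraMap (RatFunc K) U (partialD K (a i) / a i) := fun i => by
      rw [map_mul, map_intCast, mul_left_comm, S.mul_σ_logDer (ha i) (hy i), mul_add]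
    simp only [h2, Finset.sum_add_distrib, h1]
    ring
  -- The factor `p` in `σ(log x) = p log x` compensates the one in `p σ(w) = w`.
  have hinv : algebraMap (LogField K) U (logX K) * w ∈ {u : U | S.σ u = u} := by
    rw [Set.mem_ofPred_eq, map_mul, S.σ_algebraMap, sigmaLog_logX, map_mul, map_natCast]
    linear_combination algebraMap (LogField K) U (logX K) * hσw
  rw [hU] at hinv
  obtain ⟨c, hc⟩ := hinv
  have hd : S.d (algebraMap K U c) = 0 := by
    rw [IsScalarTower.algebraMap_apply K (LogField K) U, S.d_algebraMap, Derivation.map_algebraMap,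
      map_zero]
  have hcU : algebraMap K U c = algebraMap (RatFunc K) U (algebraMap K (RatFunc K) c) := by
    rw [IsScalarTower.algebraMap_apply K (LogField K) U,
      IsScalarTower.algebraMap_apply K (RatFunc K) (LogField K),
      ← IsScalarTower.algebraMap_apply (RatFunc K) (LogField K) U]
  rw [hc, Derivation.leibniz, S.d_algebraMap, partialLog_logX, map_one, smul_eq_mul, smul_eq_mul,
    mul_one] at hd
  have hdw : S.d w = ∑ i, (k i : U) * S.d (S.logDer (y i)) -
      algebraMap (RatFunc K) U (partialD K g) := by
    rw [hw, map_sub, S.d_ratFunc, map_sum]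
    congr 1
    refine Finset.sum_congr rfl fun i _ => ?_
    rw [← zsmul_eq_mul, map_zsmul, zsmul_eq_mul]
  -- The equation `w + l ∂w = 0` still involves `l`; since `c = l w`, its product with `w` is `w² +
  -- c ∂w = 0`, with coefficients in `K(x)`. Clearing denominators by `(∏ Y_j)²` gives this
  -- polynomial.
  refine ⟨logDerPoly k g ^ 2 + MvPolynomial.C (algebraMap K (RatFunc K) c) *
    logDerPoly' k (partialD K g), logDerPoly_sq_add_ne_zero hk _ _ _, ?_⟩
  have hz := fun i => S.d_eq_logDer_mul (y i)
  rw [map_add, map_pow, map_mul, aeval_logDerPoly S.d hz, aeval_logDerPoly' S.d hz, ← hdw, ← hw,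
    MvPolynomial.algHom_C, ← hcU, hc]
  linear_combination w * (∏ j, (y j : U)) ^ 2 * hd

end Backward

end Mahler

end

theorem proposition6p2 (K : Type*) [Field K] [IsAlgClosed K] [CharZero K]
    (p : ℕ) [p.AtLeastTwo]
    (U : Type*) [CommRing U] [Nontrivial U] [Algebra (Mahler.LogField K) U]
    [Algebra (RatFunc K) U] [IsScalarTower (RatFunc K) (Mahler.LogField K) U]
    [Algebra K U] [IsScalarTower K (Mahler.LogField K) U]
    (S : Mahler.SigmaPartialAlgebra K p U)
    (hU : {u : U | S.σ u = u} = Set.range (algebraMap K U))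
    (t : ℕ) (a : Fin t → RatFunc K) (ha : ∀ i, a i ≠ 0)
    (y : Fin t → Uˣ) (hy : ∀ i, S.σ (y i) = algebraMap (RatFunc K) U (a i) * y i) :
    Mahler.DiffDependent (RatFunc K) S.d (fun i => (y i : U)) ↔
      ∃ (k : Fin t → ℤ) (g : RatFunc K), k ≠ 0 ∧
        ∑ i, (k i : RatFunc K) * (Mahler.partialD K (a i) / a i) =
          (p : RatFunc K) * Mahler.sigma K p g - g :=
  ⟨Mahler.exists_coboundary_of_diffDependent S hU ha hy,
    fun ⟨_, _, hk, h⟩ => Mahler.diffDependent_of_coboundary S hU ha hy hk h⟩
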